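/- Let $(N,h)$ be a connected smooth Riemannian manifold (finite-dimensional, Hausdorff, second countable, without boundary) with $\dim N\ge 1$. Let $\pi:E\to N$ be a smooth real vector bundle of finite rank with a smooth bundle metric $\kappa$, and let $\nabla$ be a smooth connection on $E$ that is metric, i.e. $X(Y_1,Y_2)_\kappa=(\nabla_XY_1,Y_2)_\kappa+(Y_1,\nabla_XY_2)_\kappa$ for all smooth vector fields $X$ on $N$ and smooth sections $Y_1,Y_2$ of $E$. For $\xi\in T_eE$ choose a smooth curve $\alpha$ in $E$ with $\alpha'(0)=\xi$ and let $K_E(\xi):=\frac{D\alpha}{dt}(0)\in E_{\pi(e)}$, where $\frac{D}{dt}$ is the covariant derivative along $\pi\circ\alpha$ determined by $\nabla$. The Sasaki metric $\sigma$ is the Riemannian metric on the manifold $E$ given by $$(\xi_1,\xi_2)_\sigma=(d\pi(\xi_1),d\pi(\xi_2))_h+(K_E(\xi_1),K_E(\xi_2))_\kappa,\qquad \xi_1,\xi_2\in T_eE,$$ and the Sasaki distance $d_\sigma$ is its Riemannian distance, the infimum of the $\sigma$-lengths of $C^1$ curves in $E$ joining two points. Then for all $q_1,q_2\in N$, $e_1\in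 E_{q_1}$ and $e_2\in E_{q_2}$ the distance $d_\sigma(e_1,e_2)$ is finite and $$d_\sigma(e_1,e_2)^2=\inf_\gamma\left(|e_1-P^\gamma(e_2)|_\kappa^2+\Big(\int_0^1|\gamma'|_h\,dt\Big)^2\right),$$ where the infimum is taken over all piecewise regular curves $\gamma:[0,1]\to N$ with $\gamma(0)=q_1$ and $\gamma(1)=q_2$ (continuous curves for which $[0,1]$ has a finite subdivision into closed intervals on each of which $\gamma$ is smooth with nowhere vanishing velocity), and $P^\gamma:E_{q_2}\to E_{q_1}$ is parallel transport along $\gamma$ with respect to $\nabla$: $P^\gamma(e_2)=X(0)$ for the parallel section $X$ of $E$ along $\gamma$ with $X(1)=e_2$. -/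

import Mathlib

open Bundle Set Manifold
open scoped ContDiff Topology ENNReal

noncomputable section SasakiDefinitions

namespace Sasaki

variable {B : Type*} [NormedAddCommGroup B] [NormedSpace ℝ B]
  {H : Type*} [TopologicalSpace H] {I : ModelWithCorners ℝ B H}
  {N : Type*} [TopologicalSpace N] [ChartedSpace H N]
  {F : Type*} [NormedAddCommGroup F] [NormedSpace ℝ F]
  {V : N → Type*} [TopologicalSpace (TotalSpace F V)]
  [∀ x, NormedAddCommGroup (V x)] [∀ x, InnerProductSpace ℝ (V x)]
  [FiberBundle F V] [VectorBundle ℝ F V]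

variable (I F V) in
/-- The differential `dπ : T_p E → T_{π p} N` of the bundle projection `π : E → N`, where
`E = TotalSpace F V` is the total space. -/
def dproj (p : TotalSpace F V) :
    TangentSpace (I.prod 𝓘(ℝ, F)) p →L[ℝ] TangentSpace I p.proj :=
  mfderiv (I.prod 𝓘(ℝ, F)) I (TotalSpace.proj : TotalSpace F V → N) p

variable (I F V) in
/-- The differential at `p` of the fibre coordinate `E → F` in the trivialization `φ` of the
bundle around `π p`. -/
def dfibre (p : TotalSpace F V) : TangentSpace (I.prod 𝓘(ℝ, F)) p →L[ℝ] F :=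
  mfderiv (I.prod 𝓘(ℝ, F)) 𝓘(ℝ, F)
    (fun z : TotalSpace F V ↦ (trivializationAt F V p.proj z).2) p

/-- The connector operator `K : T_p E → E_{π p}` of a connection `∇` (Mathlib's `cov Y q v` is
`(∇_v Y)(q)`). In the trivialization `φ` around `q = π p`, a curve
`α` in `E` with `α' 0 = ξ` is `α t = ∑ i, a i t • s i (γ t)`, where `γ = π ∘ α` and the `s i` are the
sections that are constant in `φ`, so that by linearity and the Leibniz rule
`Dα/dt = ∑ i, a i' • s i + ∑ i, a i • ∇_{γ'} s i`. The first sum is the vector of `E_q` whose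
coordinate in `φ` is the derivative of the fibre coordinate along `ξ`; the second one is
`∇_{dπ ξ} s`, where `s = FiberBundle.extend F p.2` is the section through `p` that is constant
in `φ`. -/
def connector (cov : CovariantDerivative I F V) (p : TotalSpace F V) :
    TangentSpace (I.prod 𝓘(ℝ, F)) p →L[ℝ] V p.proj :=
  (trivializationAt F V p.proj).symmL ℝ p.proj ∘L dfibre I F V p
    + cov (FiberBundle.extend F p.2) p.proj ∘L dproj I F V p

/-- The covariant derivative `Dα/dt` at time `t` of a curve `α` in the total space, i.e. of
the section `α` along the base curve `π ∘ α`. -/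
def covDerivAlong (cov : CovariantDerivative I F V) (α : ℝ → TotalSpace F V) (t : ℝ) :
    V (α t).proj :=
  connector cov (α t) (mfderiv 𝓘(ℝ, ℝ) (I.prod 𝓘(ℝ, F)) α t (1 : ℝ))

section helpers

variable [ContMDiffVectorBundle 1 F V I]

theorem mdifferentiableAt_fibre (p z : TotalSpace F V)
    (hz : z.proj ∈ (trivializationAt F V p.proj).baseSet) :
    MDifferentiableAt (I.prod 𝓘(ℝ, F)) 𝓘(ℝ, F)
      (fun z : TotalSpace F V ↦ (trivializationAt F V p.proj z).2) z := by
  have h := (trivializationAt F V p.proj).contMDiffOn (IB := I) (n := 1)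
  have hz' : z ∈ (trivializationAt F V p.proj).source := by
    rwa [Trivialization.mem_source]
  have h2 := (h.contMDiffAt ((trivializationAt F V p.proj).open_source.mem_nhds hz')).mdifferentiableAt
    one_ne_zero
  exact h2.snd

/-- The connector is characterized by `K (dY v) = ∇_v Y`. -/
theorem connector_mfderiv_section [FiniteDimensional ℝ F] (cov : CovariantDerivative I F V)
    {Y : ∀ x, V x} {q : N}
    (hY : MDifferentiableAt I (I.prod 𝓘(ℝ, F)) (fun x ↦ TotalSpace.mk' F x (Y x)) q)
    (v : TangentSpace I q) :
    connector cov ⟨q, Y q⟩ (mfderiv I (I.prod 𝓘(ℝ, F)) (fun x ↦ TotalSpace.mk' F x (Y x)) q v)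
      = cov Y q v := by
  set e := trivializationAt F V q with he
  have hq : q ∈ e.baseSet := FiberBundle.mem_baseSet_trivializationAt' q
  let c (σ : ∀ x, V x) (x : N) : F := (e ⟨x, σ x⟩).2
  -- the difference of `∇` and of the flat connection of the trivialization is tensorial
  let Φ (σ : ∀ x, V x) : TangentSpace I q →L[ℝ] V q :=
    cov σ q - e.symmL ℝ q ∘L mvfderiv I (c σ) q
  have hc {σ : ∀ x, V x}
      (hσ : MDifferentiableAt I (I.prod 𝓘(ℝ, F)) (fun x ↦ TotalSpace.mk' F x (σ x)) q) :
      MDifferentiableAt I 𝓘(ℝ, F) (c σ) q := (mdifferentiableAt_section _ σ).1 hσ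
  have hlin {x : N} (hx : x ∈ e.baseSet) (w : V x) :
      (e ⟨x, w⟩).2 = e.continuousLinearMapAt ℝ x w := by
    rw [e.continuousLinearMapAt_apply (R := ℝ), e.coe_linearMapAt_of_mem hx]
  have hcq (σ : ∀ x, V x) : e.symmL ℝ q (c σ q) = σ q := by
    change e.symmL ℝ q (e ⟨q, σ q⟩).2 = σ q
    rw [hlin hq, e.symmL_continuousLinearMapAt hq]
  have hΦ : TensorialAt I F Φ q := by
    constructor
    · intro f σ hf hσ
      have h1 : mvfderiv I (c (f • σ)) q = mvfderiv I (f • c σ) q := by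
        have : c (f • σ) =ᶠ[𝓝 q] f • c σ := by
          filter_upwards [e.open_baseSet.mem_nhds hq] with x hx
          change (e ⟨x, f x • σ x⟩).2 = f x • (e ⟨x, σ x⟩).2
          rw [hlin hx, hlin hx, map_smul]
        ext w
        change mfderiv I 𝓘(ℝ, F) (c (f • σ)) q w = mfderiv I 𝓘(ℝ, F) (f • c σ) q w
        rw [this.mfderiv_eq]
        rfl
      ext w
      simp only [Φ, h1, cov.isCovariantDerivativeOn.leibniz hσ hf, mvfderiv_smul hf (hc hσ)]
      simp [hcq, smul_sub]
    · intro σ σ' hσ hσ'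
      have h1 : mvfderiv I (c (σ + σ')) q = mvfderiv I (c σ + c σ') q := by
        have : c (σ + σ') =ᶠ[𝓝 q] c σ + c σ' := by
          filter_upwards [e.open_baseSet.mem_nhds hq] with x hx
          change (e ⟨x, σ x + σ' x⟩).2 = (e ⟨x, σ x⟩).2 + (e ⟨x, σ' x⟩).2
          rw [hlin hx, hlin hx, hlin hx, map_add]
        ext w
        change mfderiv I 𝓘(ℝ, F) (c (σ + σ')) q w = mfderiv I 𝓘(ℝ, F) (c σ + c σ') q w
        rw [this.mfderiv_eq]
        rfl
      ext w
      simp only [Φ, h1, cov.isCovariantDerivativeOn.add hσ hσ', mvfderiv_add (hc hσ) (hc hσ')]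
      simp
      abel
  have hext : mvfderiv I (c (FiberBundle.extend F (Y q))) q = 0 := by
    have : c (FiberBundle.extend F (Y q)) =ᶠ[𝓝 q] fun _ ↦ (e ⟨q, Y q⟩).2 := by
      filter_upwards [e.open_baseSet.mem_nhds hq] with x hx
      change (e ⟨x, e.symm x (e ⟨q, Y q⟩).2⟩).2 = _
      rw [e.apply_mk_symm hx]
    ext w
    change mfderiv I 𝓘(ℝ, F) (c (FiberBundle.extend F (Y q))) q w = 0
    rw [this.mfderiv_eq, mfderiv_const]
    rfl
  have hmain := hΦ.pointwise hY (FiberBundle.mdifferentiableAt_extend I F (Y q))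
    (FiberBundle.extend_apply_self F (Y q)).symm
  have hmain' := congrArg (fun L ↦ L v) hmain
  simp only [Φ, hext, ContinuousLinearMap.comp_zero, sub_zero] at hmain'
  have h1 : dproj I F V ⟨q, Y q⟩
      (mfderiv I (I.prod 𝓘(ℝ, F)) (fun x ↦ TotalSpace.mk' F x (Y x)) q v) = v := by
    have := mfderiv_comp (I := I) (I' := I.prod 𝓘(ℝ, F)) (I'' := I) q
      (g := (TotalSpace.proj : TotalSpace F V → N)) (f := fun x ↦ TotalSpace.mk' F x (Y x))
      (mdifferentiableAt_proj V) hY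
    have h2 : mfderiv I I ((TotalSpace.proj : TotalSpace F V → N) ∘
      fun x ↦ TotalSpace.mk' F x (Y x)) q v = v := by
      change mfderiv I I id q v = v
      rw [mfderiv_id]; rfl
    rw [this] at h2
    exact h2
  have h2 : dfibre I F V ⟨q, Y q⟩
      (mfderiv I (I.prod 𝓘(ℝ, F)) (fun x ↦ TotalSpace.mk' F x (Y x)) q v)
      = mvfderiv I (c Y) q v := by
    have := mfderiv_comp (I := I) (I' := I.prod 𝓘(ℝ, F)) (I'' := 𝓘(ℝ, F)) q
      (g := fun z : TotalSpace F V ↦ (e z).2) (f := fun x ↦ TotalSpace.mk' F x (Y x))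
      (mdifferentiableAt_fibre ⟨q, Y q⟩ ⟨q, Y q⟩ hq) hY
    exact (congrArg (fun L ↦ L v) this).symm
  change e.symmL ℝ q (dfibre I F V ⟨q, Y q⟩ _) + cov (FiberBundle.extend F (Y q)) q
    (dproj I F V ⟨q, Y q⟩ _) = _
  rw [h1, h2, ← hmain']
  simp

theorem eq_zero_of_dproj_of_connector (cov : CovariantDerivative I F V) (p : TotalSpace F V)
    (ξ : TangentSpace (I.prod 𝓘(ℝ, F)) p) (h1 : dproj I F V p ξ = 0)
    (h2 : connector cov p ξ = 0) : ξ = 0 := by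
  set e := trivializationAt F V p.proj with he
  have hb : p.proj ∈ e.baseSet := FiberBundle.mem_baseSet_trivializationAt' p.proj
  have hp : p ∈ e.source := by rwa [Trivialization.mem_source]
  have h3 : dfibre I F V p ξ = 0 := by
    have h4 : e.symmL ℝ p.proj (dfibre I F V p ξ) = 0 := by
      have : connector cov p ξ = e.symmL ℝ p.proj (dfibre I F V p ξ)
        + cov (FiberBundle.extend F p.2) p.proj (dproj I F V p ξ) := rfl
      rw [this, h1, map_zero, add_zero] at h2
      exact h2
    have := congrArg (e.continuousLinearMapAt ℝ p.proj) h4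
    rwa [Trivialization.continuousLinearMapAt_symmL _ hb, map_zero] at this
  have hd : MDifferentiableAt (I.prod 𝓘(ℝ, F)) (I.prod 𝓘(ℝ, F)) e p :=
    ((e.contMDiffOn (IB := I) (n := 1)).contMDiffAt (e.open_source.mem_nhds hp)).mdifferentiableAt
      one_ne_zero
  have hds : MDifferentiableAt (I.prod 𝓘(ℝ, F)) (I.prod 𝓘(ℝ, F)) e.toOpenPartialHomeomorph.symm
      (e p) :=
    ((e.contMDiffOn_symm (IB := I) (n := 1)).contMDiffAt
      (e.open_target.mem_nhds (e.map_source hp))).mdifferentiableAt one_ne_zero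
  have hid : mfderiv (I.prod 𝓘(ℝ, F)) (I.prod 𝓘(ℝ, F)) (e.toOpenPartialHomeomorph.symm ∘ e) p
      = ContinuousLinearMap.id ℝ _ := by
    rw [← mfderiv_id]
    apply Filter.EventuallyEq.mfderiv_eq
    filter_upwards [e.open_source.mem_nhds hp] with z hz
    exact e.toOpenPartialHomeomorph.left_inv hz
  have hpair : mfderiv (I.prod 𝓘(ℝ, F)) (I.prod 𝓘(ℝ, F)) e p
      = (dproj I F V p).prod (dfibre I F V p) := by
    have h5 : mfderiv (I.prod 𝓘(ℝ, F)) (I.prod 𝓘(ℝ, F)) e p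
      = mfderiv (I.prod 𝓘(ℝ, F)) (I.prod 𝓘(ℝ, F))
        (fun z : TotalSpace F V ↦ (z.proj, (e z).2)) p := by
      apply Filter.EventuallyEq.mfderiv_eq
      filter_upwards [e.open_source.mem_nhds hp] with z hz
      exact Prod.ext (e.coe_fst hz) rfl
    rw [h5]
    exact mfderiv_prodMk (mdifferentiableAt_proj V) (mdifferentiableAt_fibre p p hb)
  have hξ : mfderiv (I.prod 𝓘(ℝ, F)) (I.prod 𝓘(ℝ, F)) e p ξ = 0 := by
    rw [hpair]
    exact Prod.ext h1 h3
  have := congrArg (fun L ↦ L ξ) hid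
  rw [mfderiv_comp p hds hd] at this
  change mfderiv (I.prod 𝓘(ℝ, F)) (I.prod 𝓘(ℝ, F)) e.toOpenPartialHomeomorph.symm (e p)
    (mfderiv (I.prod 𝓘(ℝ, F)) (I.prod 𝓘(ℝ, F)) e p ξ) = ξ at this
  rw [← this, hξ]
  exact map_zero _

end helpers

section metric

variable [ContMDiffVectorBundle 1 F V I]
  [FiniteDimensional ℝ B] [FiniteDimensional ℝ F]
  [RiemannianBundle (fun x : N ↦ TangentSpace I x)]

/-- The Sasaki metric on the total space:
`(ξ₁, ξ₂) ↦ (dπ ξ₁, dπ ξ₂)_h + (K ξ₁, K ξ₂)_κ` on `T_p E`. -/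
def sasakiMetric (cov : CovariantDerivative I F V) :
    RiemannianMetric (fun p : TotalSpace F V ↦ TangentSpace (I.prod 𝓘(ℝ, F)) p) where
  inner p := (dproj I F V p).precomp ℝ ∘L innerSL ℝ (E := TangentSpace I p.proj) ∘L dproj I F V p
    + (connector cov p).precomp ℝ ∘L innerSL ℝ (E := V p.proj) ∘L connector cov p
  symm p ξ η := by
    change inner ℝ (dproj I F V p ξ) (dproj I F V p η)
        + inner ℝ (connector cov p ξ) (connector cov p η)
      = inner ℝ (dproj I F V p η) (dproj I F V p ξ)
        + inner ℝ (connector cov p η) (connector cov p ξ)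
    rw [real_inner_comm, real_inner_comm (connector cov p η)]
  pos p ξ hξ := by
    change 0 < inner ℝ (dproj I F V p ξ) (dproj I F V p ξ)
        + inner ℝ (connector cov p ξ) (connector cov p ξ)
    by_contra h
    have h1 := real_inner_self_nonneg (x := dproj I F V p ξ)
    have h2 := real_inner_self_nonneg (x := connector cov p ξ)
    exact hξ (eq_zero_of_dproj_of_connector cov p ξ
      (inner_self_eq_zero (𝕜 := ℝ).1 (by linarith)) (inner_self_eq_zero (𝕜 := ℝ).1 (by linarith)))
  continuousAt p := by
    change ContinuousAt (fun ξ ↦ inner ℝ (dproj I F V p ξ) (dproj I F V p ξ)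
        + inner ℝ (connector cov p ξ) (connector cov p ξ)) 0
    exact ((((dproj I F V p).continuous).inner (dproj I F V p).continuous).add
      ((connector cov p).continuous.inner (connector cov p).continuous)).continuousAt
  isVonNBounded p := by
    let A : B × F →L[ℝ] TangentSpace I p.proj × V p.proj :=
      ContinuousLinearMap.prod (dproj I F V p) (connector cov p)
    have hA : LinearMap.ker A.toLinearMap = ⊥ := by
      rw [LinearMap.ker_eq_bot']
      intro ξ hξ
      have h1 : dproj I F V p ξ = 0 := congrArg Prod.fst hξ
      have h2 : connector cov p ξ = 0 := congrArg Prod.snd hξ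
      exact eq_zero_of_dproj_of_connector cov p ξ h1 h2
    obtain ⟨K, -, hK⟩ := A.toLinearMap.exists_antilipschitzWith hA
    have hb : Bornology.IsBounded (A ⁻¹' Metric.ball 0 1) :=
      hK.isBounded_preimage Metric.isBounded_ball
    change Bornology.IsVonNBounded ℝ {ξ : B × F | inner ℝ (dproj I F V p ξ) (dproj I F V p ξ)
        + inner ℝ (connector cov p ξ) (connector cov p ξ) < 1}
    refine (NormedSpace.isVonNBounded_iff ℝ).2 (hb.subset ?_)
    intro ξ hξ
    change inner ℝ (dproj I F V p ξ) (dproj I F V p ξ)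
        + inner ℝ (connector cov p ξ) (connector cov p ξ) < 1 at hξ
    rw [real_inner_self_eq_norm_sq, real_inner_self_eq_norm_sq] at hξ
    rw [mem_preimage, mem_ball_zero_iff]
    change max ‖dproj I F V p ξ‖ ‖connector cov p ξ‖ < 1
    rw [max_lt_iff]
    constructor <;> nlinarith [norm_nonneg (dproj I F V p ξ), norm_nonneg (connector cov p ξ)]

/-- The Sasaki distance: the Riemannian distance of the Sasaki metric on the total space. -/
def sasakiEDist (cov : CovariantDerivative I F V) (e₁ e₂ : TotalSpace F V) : ℝ≥0∞ :=
  letI : RiemannianBundle (fun p : TotalSpace F V ↦ TangentSpace (I.prod 𝓘(ℝ, F)) p) :=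
    ⟨sasakiMetric cov⟩
  riemannianEDist (I.prod 𝓘(ℝ, F)) e₁ e₂

end metric

variable (I) in
/-- `γ` restricted to `[0, 1]` is a piecewise regular curve: there is a subdivision
`0 = τ 0 < τ 1 < ⋯ < τ m = 1` such that on each closed subinterval `γ` is smooth with
nowhere vanishing velocity (one-sided at the end points). Continuity on `[0, 1]` follows. -/
def IsPiecewiseRegular (γ : ℝ → N) : Prop :=
  ∃ (m : ℕ) (τ : ℕ → ℝ), τ 0 = 0 ∧ τ m = 1 ∧ ∀ i < m, τ i < τ (i + 1) ∧
    ContMDiffOn 𝓘(ℝ, ℝ) I ∞ γ (Icc (τ i) (τ (i + 1))) ∧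
    ∀ t ∈ Icc (τ i) (τ (i + 1)),
      mfderivWithin 𝓘(ℝ, ℝ) I γ (Icc (τ i) (τ (i + 1))) t (1 : ℝ) ≠ 0

/-- `α`, a curve in the total space, is on `[0, 1]` a parallel section along `γ`:
it lies over `γ`, is continuous and satisfies `Dα/dt = 0` except at finitely many times (corners
of `γ`, end points). -/
def IsParallelAlong (cov : CovariantDerivative I F V) (γ : ℝ → N) (α : ℝ → TotalSpace F V) :
    Prop :=
  (∀ t ∈ Icc (0 : ℝ) 1, (α t).proj = γ t) ∧ ContinuousOn α (Icc 0 1) ∧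
    ∃ S : Set ℝ, S.Finite ∧ ∀ t ∈ Icc (0 : ℝ) 1 \ S,
      MDifferentiableAt 𝓘(ℝ, ℝ) (I.prod 𝓘(ℝ, F)) α t ∧ covDerivAlong cov α t = 0

/-- Parallel transport `P^γ : E_{q₂} → E_{q₁}` along a piecewise smooth curve `γ` on `[0, 1]` from
`q₁` to `q₂`: the value at time `0` of the parallel section along `γ` with value `e` at time `1`.
(Such a section exists and is unique, the parallel equation being a linear ODE.) -/
def parallelTransport (cov : CovariantDerivative I F V) (γ : ℝ → N) {q₁ q₂ : N} (e : V q₂) :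
    V q₁ :=
  Classical.epsilon fun w ↦ ∃ α : ℝ → TotalSpace F V, IsParallelAlong cov γ α ∧
    α 0 = ⟨q₁, w⟩ ∧ α 1 = ⟨q₂, e⟩

end Sasaki

end SasakiDefinitions

/-!
The Sasaki metric splits the velocity of a curve `β` of `E` over `γ` orthogonally into `γ'` and
`Dβ/dt`, so the length of `β` is `∫ √(|γ'|² + |Dβ/dt|²)`. By Minkowski's inequality its square is
at least `L(γ)² + (∫ |Dβ/dt|)²`, and `∫ |Dβ/dt| ≥ |β 0 - P^γ (β 1)|` because the difference between
`β` and the parallel section ending at `β 1` has the same covariant derivative as `β`, which bounds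
the growth of its norm. Equality holds for `β = X + c Y`, where `X` and `Y` are parallel along `γ`,
`X 1 = e₂`, `Y 0 = e₁ - X 0`, and `c` decreases from `1` to `0` proportionally to arc length.

The distance of `E` is an infimum over `C¹` curves, whose projections need not be piecewise regular.
In a small chart of `E` the metric is almost constant, so that such a curve can be replaced, at an
arbitrarily small cost in length, by segments of the chart; a vertical segment, whose projection is
constant, is first perturbed into two segments that are not vertical.
-/

noncomputable section

namespace Sasaki

open Filter MeasureTheory

section Interval

/-- The relation `P` holds between the end points of every subinterval of `[a, b]` that has no point
of a suitable finite set in its interior. -/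
def PiecewiseOn (P : ℝ → ℝ → Prop) (a b : ℝ) : Prop :=
  ∃ S : Set ℝ, S.Finite ∧ ∀ s s', s < s' → Icc s s' ⊆ Icc a b → Disjoint (Ioo s s') S → P s s'

variable {P Q R : ℝ → ℝ → Prop} {a b c : ℝ}

theorem rel_of_forall_nhdsWithin (hab : a < b)
    (htrans : ∀ s t u, s < t → t < u → R s t → R t u → R s u)
    (hloc : ∀ t ∈ Icc a b, ∃ U ∈ 𝓝[Icc a b] t, ∀ s s', s < s' → Icc s s' ⊆ Icc a b →
      Icc s s' ⊆ U → R s s') : R a b := by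
  have hopen : ∀ t : Icc a b, ∃ O : Set ℝ, IsOpen O ∧ (t : ℝ) ∈ O ∧ ∀ s s', s < s' →
      Icc s s' ⊆ Icc a b → Icc s s' ⊆ O → R s s' := by
    intro t
    obtain ⟨U, hU, hR⟩ := hloc t t.2
    obtain ⟨O, hO, htO, hOU⟩ := mem_nhdsWithin.1 hU
    exact ⟨O, hO, htO, fun s s' h hI hsO ↦ hR s s' h hI (subset_trans (subset_inter hsO hI) hOU)⟩
  choose O hO hmem hR using hopen
  obtain ⟨τ, h0, hmono, ⟨m, hm⟩, hsub⟩ := exists_monotone_Icc_subset_open_cover_Icc hab.le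
    (fun i ↦ (hO i).preimage continuous_subtype_val) fun x _ ↦ mem_iUnion.2 ⟨x, hmem x⟩
  have hstep (n : ℕ) (hlt : (τ n : ℝ) < τ (n + 1)) : R (τ n) (τ (n + 1)) := by
    have hI : Icc (τ n : ℝ) (τ (n + 1)) ⊆ Icc a b := Icc_subset_Icc (τ n).2.1 (τ (n + 1)).2.2
    obtain ⟨i, hi⟩ := hsub n
    exact hR i _ _ hlt hI fun t ht ↦ @hi ⟨t, hI ht⟩ ht
  have hreach (n : ℕ) : (τ n : ℝ) = a ∨ R a (τ n) := by
    induction n with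
    | zero => exact .inl (by rw [h0])
    | succ n ih =>
      rcases (show (τ n : ℝ) ≤ τ (n + 1) from hmono n.le_succ).eq_or_lt with heq | hlt
      · rwa [← heq]
      rcases (τ n).2.1.eq_or_lt with ha | ha
      · exact .inr (by have h := hstep n hlt; rwa [← ha] at h)
      · exact .inr (htrans _ _ _ ha hlt (ih.resolve_left ha.ne') (hstep n hlt))
  have hend := hreach m
  rw [hm m le_rfl] at hend
  exact hend.resolve_left hab.ne'

namespace PiecewiseOn

theorem of_forall (h : ∀ s s', s < s' → Icc s s' ⊆ Icc a b → P s s') : PiecewiseOn P a b :=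
  ⟨∅, finite_empty, fun s s' hlt hsub _ ↦ h s s' hlt hsub⟩

theorem mono (h : PiecewiseOn P a b)
    (hPQ : ∀ s s', s < s' → Icc s s' ⊆ Icc a b → P s s' → Q s s') : PiecewiseOn Q a b :=
  let ⟨S, hS, h⟩ := h
  ⟨S, hS, fun s s' hlt hsub hdisj ↦ hPQ s s' hlt hsub (h s s' hlt hsub hdisj)⟩

theorem and (hP : PiecewiseOn P a b) (hQ : PiecewiseOn Q a b) :
    PiecewiseOn (fun s s' ↦ P s s' ∧ Q s s') a b := by
  obtain ⟨S, hS, hP⟩ := hP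
  obtain ⟨S', hS', hQ⟩ := hQ
  refine ⟨S ∪ S', hS.union hS', fun s s' hlt hsub hdisj ↦ ?_⟩
  rw [disjoint_union_right] at hdisj
  exact ⟨hP s s' hlt hsub hdisj.1, hQ s s' hlt hsub hdisj.2⟩

theorem trans (hab : PiecewiseOn P a b) (hbc : PiecewiseOn P b c) : PiecewiseOn P a c := by
  obtain ⟨S, hS, hab⟩ := hab
  obtain ⟨S', hS', hbc⟩ := hbc
  refine ⟨{b} ∪ (S ∪ S'), (finite_singleton b).union (hS.union hS'), fun s s' hlt hsub hdisj ↦ ?_⟩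
  rw [disjoint_union_right, disjoint_union_right, disjoint_singleton_right] at hdisj
  obtain ⟨hb, hdS, hdS'⟩ := hdisj
  obtain ⟨has, hsc⟩ := (Icc_subset_Icc_iff hlt.le).1 hsub
  rcases le_or_gt s' b with hsb | hbs
  · exact hab s s' hlt (Icc_subset_Icc has hsb) hdS
  · exact hbc s s' hlt (Icc_subset_Icc (not_lt.1 fun h ↦ hb ⟨h, hbs⟩) hsc) hdS'

theorem rel (h : PiecewiseOn R a b) (hab : a < b)
    (htrans : ∀ s t u, s < t → t < u → R s t → R t u → R s u) : R a b := by
  obtain ⟨S, hS, h⟩ := h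
  refine rel_of_forall_nhdsWithin hab htrans fun t _ ↦ ?_
  have hU : (S \ {t})ᶜ ∈ 𝓝 t := (hS.subset sdiff_subset).isClosed.isOpen_compl.mem_nhds (by simp)
  refine ⟨_, nhdsWithin_le_nhds hU, fun s s' hlt hI hsub ↦ ?_⟩
  have hrel : ∀ r r', r < r' → Icc r r' ⊆ Icc s s' → t ∉ Ioo r r' → R r r' :=
    fun r r' hr hrs htr ↦ h r r' hr (hrs.trans hI) (Set.disjoint_left.2 fun x hx hxS ↦
      hsub (hrs (Ioo_subset_Icc_self hx)) ⟨hxS, fun hxt ↦ htr (hxt ▸ hx)⟩)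
  by_cases ht : t ∈ Ioo s s'
  · exact htrans s t s' ht.1 ht.2
      (hrel s t ht.1 (Icc_subset_Icc_right ht.2.le) fun h ↦ h.2.false)
      (hrel t s' ht.2 (Icc_subset_Icc_left ht.1.le) fun h ↦ h.1.false)
  · exact hrel s s' hlt Subset.rfl ht

theorem eventually_cofinite (h : PiecewiseOn P a b) :
    ∀ᶠ t in cofinite, t ∈ Icc a b → ∃ s s', t ∈ Ioo s s' ∧ Icc s s' ⊆ Icc a b ∧ P s s' := by
  obtain ⟨S, hS, h⟩ := h
  filter_upwards [(finite_singleton a).compl_mem_cofinite, (finite_singleton b).compl_mem_cofinite,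
    hS.compl_mem_cofinite] with t hta htb htS ht
  have hnhds : Ioo a b ∩ Sᶜ ∈ 𝓝 t := inter_mem
    (Ioo_mem_nhds (lt_of_le_of_ne' ht.1 hta) (lt_of_le_of_ne ht.2 htb))
    (hS.isClosed.isOpen_compl.mem_nhds htS)
  obtain ⟨s, s', -, hIcc, hsub⟩ := exists_Icc_mem_subset_of_mem_nhds hnhds
  have hs : t ∈ Ioo s s' := by rwa [← interior_Icc, mem_interior_iff_mem_nhds]
  have hI : Icc s s' ⊆ Icc a b := (hsub.trans inter_subset_left).trans Ioo_subset_Icc_self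
  exact ⟨s, s', hs, hI, h s s' (hs.1.trans hs.2) hI
    (Set.disjoint_left.2 fun x hx ↦ (hsub (Ioo_subset_Icc_self hx)).2)⟩

end PiecewiseOn

theorem exists_glue {X : ℝ → Type*} {f g : ∀ t, X t} (h : f b = g b) :
    ∃ k : ∀ t, X t, (∀ t ≤ b, k t = f t) ∧ ∀ t ≥ b, k t = g t := by
  classical
  have hleft : ∀ t ≤ b, (Iic b).piecewise f g t = f t := fun t ht ↦ piecewise_eq_of_mem _ _ _ ht
  refine ⟨_, hleft, fun t ht ↦ ?_⟩
  rcases ht.eq_or_lt with rfl | hlt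
  · rw [hleft _ le_rfl, h]
  · exact piecewise_eq_of_notMem _ _ _ hlt.not_ge

theorem ae_restrict_Icc_of_cofinite {p : ℝ → Prop}
    (h : ∀ᶠ t in cofinite, t ∈ Icc a b → p t) : ∀ᵐ t ∂volume.restrict (Icc a b), p t :=
  (ae_restrict_iff' measurableSet_Icc).2 (ae_iff.2 ((eventually_cofinite.1 h).measure_zero _))

end Interval

section Analysis

theorem enorm_sub_le_lintegral {W : Type*} [NormedAddCommGroup W] [NormedSpace ℝ W]
    [CompleteSpace W] {a b : ℝ} (hab : a ≤ b) {u : ℝ → W} (hu : ContinuousOn u (Icc a b))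
    {k : ℝ → ℝ≥0∞}
    (hk : ∀ᶠ t in cofinite, t ∈ Icc a b → DifferentiableAt ℝ u t ∧ ‖deriv u t‖ₑ ≤ k t) :
    ‖u b - u a‖ₑ ≤ ∫⁻ t in Icc a b, k t := by
  have hle : ∫⁻ t in Icc a b, ‖deriv u t‖ₑ ≤ ∫⁻ t in Icc a b, k t :=
    lintegral_mono_ae ((ae_restrict_Icc_of_cofinite hk).mono fun t ht ↦ ht.2)
  by_cases htop : ∫⁻ t in Icc a b, k t = ⊤
  · exact htop ▸ le_top
  have hint : IntegrableOn (deriv u) (Icc a b) :=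
    ⟨(stronglyMeasurable_deriv u).aestronglyMeasurable, hle.trans_lt (lt_top_iff_ne_top.2 htop)⟩
  have hftc := integral_eq_of_hasDerivAt_off_countable u (deriv u)
    (eventually_cofinite.1 hk).countable (by rwa [uIcc_of_le hab])
    (fun t ht ↦ by
      rw [min_eq_left hab, max_eq_right hab] at ht
      exact (not_not.1 ht.2 (Ioo_subset_Icc_self ht.1)).1.hasDerivAt)
    ((intervalIntegrable_iff_integrableOn_Icc_of_le hab).2 hint)
  rw [← hftc, intervalIntegral.integral_of_le hab, ← integral_Icc_eq_integral_Ioc]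
  exact (enorm_integral_le_lintegral_enorm _).trans hle

theorem exists_sq_eq (c : ℝ≥0∞) : ∃ r : ℝ≥0∞, r ^ 2 = c :=
  ⟨c ^ (2⁻¹ : ℝ), ENNReal.rpow_inv_natCast_pow two_ne_zero c⟩

theorem le_sq_of_forall_gt {c d : ℝ≥0∞} (h : ∀ r > d, c ≤ r ^ 2) : c ≤ d ^ 2 := by
  obtain ⟨s, rfl⟩ := exists_sq_eq c
  gcongr
  exact le_of_forall_gt_imp_ge_of_dense fun r hr ↦
    (ENNReal.pow_le_pow_left_iff two_ne_zero).1 (h r hr)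

theorem mul_add_mul_sq_le (a b x y : ℝ≥0∞) :
    (a * x + b * y) ^ 2 ≤ (a ^ 2 + b ^ 2) * (x ^ 2 + y ^ 2) := by
  have htwo (p q : ℝ≥0∞) : 2 * (p * q) ≤ p ^ 2 + q ^ 2 := by
    wlog hpq : p ≤ q generalizing p q
    · rw [mul_comm p, add_comm]
      exact this q p (le_of_not_ge hpq)
    obtain ⟨r, rfl⟩ := exists_add_of_le hpq
    calc 2 * (p * (p + r)) ≤ 2 * (p * (p + r)) + r ^ 2 := le_self_add
      _ = p ^ 2 + (p + r) ^ 2 := by ring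
  calc (a * x + b * y) ^ 2
      = (a * x) ^ 2 + (b * y) ^ 2 + 2 * ((a * y) * (b * x)) := by ring
    _ ≤ (a * x) ^ 2 + (b * y) ^ 2 + ((a * y) ^ 2 + (b * x) ^ 2) := by gcongr; exact htwo _ _
    _ = (a ^ 2 + b ^ 2) * (x ^ 2 + y ^ 2) := by ring

theorem sq_lintegral_add_sq_lintegral_le {X : Type*} [MeasurableSpace X] {μ : Measure X}
    {f g h : X → ℝ≥0∞} (hfg : ∀ᵐ x ∂μ, f x ^ 2 + g x ^ 2 ≤ h x ^ 2) :
    (∫⁻ x, f x ∂μ) ^ 2 + (∫⁻ x, g x ∂μ) ^ 2 ≤ (∫⁻ x, h x ∂μ) ^ 2 := by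
  have hsq {x y : ℝ≥0∞} (hxy : x ^ 2 ≤ y ^ 2) : x ≤ y :=
    (ENNReal.pow_le_pow_left_iff two_ne_zero).1 hxy
  by_cases htop : ∫⁻ x, h x ∂μ = ⊤
  · simp [htop]
  set a := ∫⁻ x, f x ∂μ with ha
  set b := ∫⁻ x, g x ∂μ with hb
  have hatop : a ≠ ⊤ := ne_top_of_le_ne_top htop
    (lintegral_mono_ae (hfg.mono fun x hx ↦ hsq (le_self_add.trans hx)))
  have hbtop : b ≠ ⊤ := ne_top_of_le_ne_top htop
    (lintegral_mono_ae (hfg.mono fun x hx ↦ hsq (le_add_self.trans hx)))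
  have hrtop : a ^ 2 + b ^ 2 ≠ ⊤ := by finiteness
  obtain ⟨r, hr⟩ := exists_sq_eq (a ^ 2 + b ^ 2)
  have hpoint : ∀ᵐ x ∂μ, a * f x + b * g x ≤ r * h x := by
    filter_upwards [hfg] with x hx
    refine hsq ((mul_add_mul_sq_le _ _ _ _).trans ?_)
    rw [mul_pow, hr]
    gcongr
  have hr0 : r ≠ ⊤ := fun h ↦ hrtop (by simp [← hr, h])
  have hle : r * r ≤ r * ∫⁻ x, h x ∂μ := calc
    r * r = a * ∫⁻ x, f x ∂μ + b * ∫⁻ x, g x ∂μ := by rw [← sq, hr, ← ha, ← hb, sq, sq]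
    _ ≤ ∫⁻ x, a * f x ∂μ + ∫⁻ x, b * g x ∂μ := by gcongr <;> exact lintegral_const_mul_le _ _
    _ ≤ ∫⁻ x, (a * f x + b * g x) ∂μ := le_lintegral_add _ _
    _ ≤ ∫⁻ x, r * h x ∂μ := lintegral_mono_ae hpoint
    _ = r * ∫⁻ x, h x ∂μ := lintegral_const_mul' _ _ hr0
  rw [← hr]
  gcongr
  rcases eq_or_ne r 0 with hz | hz
  · simp [hz]
  · exact (ENNReal.mul_le_mul_iff_right hz hr0).1 hle

theorem sq_lintegral_le_of_sq_eq {X : Type*} [MeasurableSpace X] {μ : Measure X}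
    {u v : X → ℝ≥0∞} {d : ℝ≥0∞} (hd : d ≠ ⊤) (h₀ : ∫⁻ x, v x ∂μ ≠ 0) (h₁ : ∫⁻ x, v x ∂μ ≠ ⊤)
    (huv : ∀ᵐ x ∂μ, u x ^ 2 = v x ^ 2 + (v x / (∫⁻ x, v x ∂μ) * d) ^ 2) :
    (∫⁻ x, u x ∂μ) ^ 2 ≤ (∫⁻ x, v x ∂μ) ^ 2 + d ^ 2 := by
  set L := ∫⁻ x, v x ∂μ with hL
  obtain ⟨k, hk⟩ := exists_sq_eq (1 + (L⁻¹ * d) ^ 2)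
  have hktop : k ≠ ⊤ := by
    rintro rfl
    have hfin : 1 + (L⁻¹ * d) ^ 2 ≠ ⊤ := by finiteness
    exact hfin (by simp [← hk])
  have hpoint : ∀ᵐ x ∂μ, u x ≤ k * v x := by
    filter_upwards [huv] with x hx
    refine (ENNReal.pow_le_pow_left_iff two_ne_zero).1 (le_of_eq ?_)
    rw [hx, mul_pow k, hk, div_eq_mul_inv]
    ring
  calc (∫⁻ x, u x ∂μ) ^ 2 ≤ (k * L) ^ 2 := by
        rw [hL, ← lintegral_const_mul' _ _ hktop]
        gcongr ?_ ^ 2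
        exact lintegral_mono_ae hpoint
    _ = L ^ 2 + (L⁻¹ * L * d) ^ 2 := by rw [mul_pow, hk]; ring
    _ = L ^ 2 + d ^ 2 := by rw [ENNReal.inv_mul_cancel h₀ h₁, one_mul]

theorem dense_compl_pair {E : Type*} [NormedAddCommGroup E] [NormedSpace ℝ E] [Nontrivial E]
    (u v : E) : Dense ({u, v}ᶜ : Set E) :=
  (toFinite {u, v}).countable.dense_compl ℝ

theorem exists_linear_ode {F : Type*} [NormedAddCommGroup F] [NormedSpace ℝ F] [CompleteSpace F]
    {a b : ℝ} {A : ℝ → F →L[ℝ] F} (hA : ContinuousOn A (Icc a b)) {M : ℝ}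
    (hM : ∀ t ∈ Icc a b, ‖A t‖ ≤ M) (hab : M * (b - a) ≤ 1 / 2) {t₀ : ℝ} (ht₀ : t₀ ∈ Icc a b)
    (x₀ : F) :
    ∃ f : ℝ → F, f t₀ = x₀ ∧ ∀ t ∈ Icc a b, HasDerivWithinAt f (A t (f t)) (Icc a b) t := by
  lift M to NNReal using (norm_nonneg _).trans (hM t₀ ht₀)
  have hpl : IsPicardLindelof (fun t x ↦ A t x) (tmin := a) (tmax := b) ⟨t₀, ht₀⟩ x₀
      ‖x₀‖₊ 0 (2 * M * ‖x₀‖₊) M := by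
    refine ⟨fun t ht ↦ ?_, fun x _ ↦ hA.clm_apply continuousOn_const, fun t ht x hx ↦ ?_, ?_⟩
    · exact ((A t).lipschitz.weaken (hM t ht)).lipschitzOnWith
    · have hx' : ‖x - x₀‖ ≤ ‖x₀‖ := mem_closedBall_iff_norm.1 hx
      calc ‖A t x‖ ≤ ‖A t‖ * ‖x‖ := (A t).le_opNorm x
        _ ≤ M * (2 * ‖x₀‖) := by
          gcongr
          · exact hM t ht
          · linarith [norm_le_norm_add_norm_sub' x x₀]
        _ = (2 * M * ‖x₀‖₊ : NNReal) := by push_cast; ring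
    · have hmax : max (b - t₀) (t₀ - a) ≤ b - a :=
        max_le (by linarith [ht₀.1]) (by linarith [ht₀.2])
      push_cast
      calc 2 * M * ‖x₀‖ * max (b - t₀) (t₀ - a) ≤ 2 * M * ‖x₀‖ * (b - a) := by gcongr
        _ = 2 * (M * (b - a)) * ‖x₀‖ := by ring
        _ ≤ 2 * (1 / 2) * ‖x₀‖ := by gcongr
        _ = ‖x₀‖ - 0 := by ring
  exact hpl.exists_eq_forall_mem_Icc_hasDerivWithinAt₀

end Analysis

section Connector

variable {B : Type*} [NormedAddCommGroup B] [NormedSpace ℝ B]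
  {H : Type*} [TopologicalSpace H] {I : ModelWithCorners ℝ B H}
  {N : Type*} [TopologicalSpace N] [ChartedSpace H N]
  {F : Type*} [NormedAddCommGroup F] [NormedSpace ℝ F]
  {V : N → Type*} [TopologicalSpace (TotalSpace F V)]
  [∀ x, NormedAddCommGroup (V x)] [FiberBundle F V]
  {q₀ q : N}

theorem dproj_mfderiv_section {Y : ∀ x, V x}
    (hY : MDifferentiableAt I (I.prod 𝓘(ℝ, F)) (fun x ↦ TotalSpace.mk' F x (Y x)) q)
    (v : TangentSpace I q) :
    dproj I F V ⟨q, Y q⟩ (mfderiv I (I.prod 𝓘(ℝ, F)) (fun x ↦ TotalSpace.mk' F x (Y x)) q v)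
      = v := by
  have hcomp := mfderiv_comp_apply (I' := I.prod 𝓘(ℝ, F)) q
    (g := (TotalSpace.proj : TotalSpace F V → N)) (mdifferentiableAt_proj V) hY v
  exact hcomp.symm.trans (congrArg (fun L ↦ L v) (mfderiv_id (I := I) (x := q)))

variable [∀ x, InnerProductSpace ℝ (V x)] [VectorBundle ℝ F V]

/-- The section with constant coordinate `f` in the trivialization of the bundle around `q₀`
(zero outside the domain of the trivialization). -/
def constSection (q₀ : N) (f : F) (x : N) : V x := (trivializationAt F V q₀).symmL ℝ x f

theorem trivializationAt_eq_continuousLinearMapAt (hq : q ∈ (trivializationAt F V q₀).baseSet)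
    (w : V q) :
    (trivializationAt F V q₀ ⟨q, w⟩).2 = (trivializationAt F V q₀).continuousLinearMapAt ℝ q w := by
  rw [Trivialization.continuousLinearMapAt_apply (R := ℝ),
    Trivialization.coe_linearMapAt_of_mem _ hq]

theorem trivializationAt_constSection (hq : q ∈ (trivializationAt F V q₀).baseSet) (f : F) :
    (trivializationAt F V q₀ ⟨q, constSection q₀ f q⟩).2 = f := by
  rw [constSection, Trivialization.symmL_apply _ hq, Trivialization.apply_mk_symm _ hq]

theorem constSection_trivializationAt (hq : q ∈ (trivializationAt F V q₀).baseSet) (w : V q) :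
    constSection q₀ (trivializationAt F V q₀ ⟨q, w⟩).2 q = w := by
  rw [constSection, Trivialization.symmL_apply _ hq, Trivialization.symm_apply_apply_mk _ hq]

theorem constSection_add (q₀ : N) (f g : F) :
    constSection (V := V) q₀ (f + g) = constSection q₀ f + constSection q₀ g :=
  funext fun x ↦ map_add ((trivializationAt F V q₀).symmL ℝ x) f g

theorem constSection_smul (q₀ : N) (c : ℝ) (f : F) :
    constSection (V := V) q₀ (c • f) = c • constSection q₀ f :=
  funext fun x ↦ map_smul ((trivializationAt F V q₀).symmL ℝ x) c f

theorem contMDiffOn_constSection {n : WithTop ℕ∞} [ContMDiffVectorBundle n F V I]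
    (q₀ : N) (f : F) :
    ContMDiffOn I (I.prod 𝓘(ℝ, F)) n (fun x ↦ TotalSpace.mk' F x (constSection (V := V) q₀ f x))
      (trivializationAt F V q₀).baseSet := by
  intro x hx
  rw [(trivializationAt F V q₀).contMDiffWithinAt_section _ hx]
  exact contMDiffWithinAt_const.congr (fun y hy ↦ trivializationAt_constSection hy f)
    (trivializationAt_constSection hx f)

theorem mdifferentiableAt_normSq [IsContMDiffRiemannianBundle I 1 F V] (p : TotalSpace F V) :
    MDifferentiableAt (I.prod 𝓘(ℝ, F)) 𝓘(ℝ, ℝ) (fun z : TotalSpace F V ↦ inner ℝ z.2 z.2) p :=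
  MDifferentiableAt.inner_bundle (b := fun z : TotalSpace F V ↦ z.proj) (v := fun z ↦ z.2)
    (w := fun z ↦ z.2) (IB := I) (F := F) mdifferentiableAt_id mdifferentiableAt_id

variable [ContMDiffVectorBundle 1 F V I]

theorem mdifferentiableAt_constSection (hq : q ∈ (trivializationAt F V q₀).baseSet) (f : F) :
    MDifferentiableAt I (I.prod 𝓘(ℝ, F))
      (fun x ↦ TotalSpace.mk' F x (constSection (V := V) q₀ f x)) q :=
  ((contMDiffOn_constSection (n := 1) q₀ f).contMDiffAt
    ((trivializationAt F V q₀).open_baseSet.mem_nhds hq)).mdifferentiableAt one_ne_zero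

theorem mdifferentiableAt_fibreCoord {p : TotalSpace F V}
    (hp : p.proj ∈ (trivializationAt F V q₀).baseSet) :
    MDifferentiableAt (I.prod 𝓘(ℝ, F)) 𝓘(ℝ, F)
      (fun z : TotalSpace F V ↦ (trivializationAt F V q₀ z).2) p :=
  mdifferentiableAt_fibre (⟨q₀, 0⟩ : TotalSpace F V) p hp

variable (I) in
/-- The canonical embedding of the fibre `E_{π p}` into `T_p E` as the vertical subspace: the
differential at `p` of the inclusion of the fibre into the total space. -/
def verticalLift (p : TotalSpace F V) :
    V p.proj →L[ℝ] TangentSpace (I.prod 𝓘(ℝ, F)) p :=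
  mfderiv 𝓘(ℝ, V p.proj) (I.prod 𝓘(ℝ, F)) (TotalSpace.mk' F p.proj) p.2

theorem mdifferentiable_totalSpaceMk (q : N) :
    MDifferentiable 𝓘(ℝ, V q) (I.prod 𝓘(ℝ, F)) (TotalSpace.mk' F q : V q → TotalSpace F V) := by
  intro w
  have hq := FiberBundle.mem_baseSet_trivializationAt' (F := F) (E := V) q
  refine ((trivializationAt F V q).mdifferentiableAt_totalSpace_iff I _
    ((Trivialization.mem_source _).2 hq)).2 ⟨mdifferentiableAt_const, ?_⟩
  exact ((trivializationAt F V q).continuousLinearMapAt ℝ q).mdifferentiableAt.congr_of_eventuallyEq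
    (.of_forall fun w ↦ trivializationAt_eq_continuousLinearMapAt hq w)

theorem dproj_verticalLift (p : TotalSpace F V) (u : V p.proj) :
    dproj I F V p (verticalLift I p u) = 0 := by
  have hcomp := mfderiv_comp_apply (I' := I.prod 𝓘(ℝ, F)) p.2
    (g := (TotalSpace.proj : TotalSpace F V → N)) (mdifferentiableAt_proj V)
    (mdifferentiable_totalSpaceMk (I := I) p.proj p.2) u
  refine hcomp.symm.trans ?_
  rw [show TotalSpace.proj ∘ TotalSpace.mk' F p.proj = fun _ : V p.proj ↦ p.proj from rfl,
    mfderiv_const]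
  rfl

theorem mfderiv_fibreCoord_verticalLift {p : TotalSpace F V}
    (hp : p.proj ∈ (trivializationAt F V q₀).baseSet) (u : V p.proj) :
    mfderiv (I.prod 𝓘(ℝ, F)) 𝓘(ℝ, F) (fun z : TotalSpace F V ↦ (trivializationAt F V q₀ z).2) p
      (verticalLift I p u) = (trivializationAt F V q₀).continuousLinearMapAt ℝ p.proj u := by
  have hcomp := mfderiv_comp_apply (I' := I.prod 𝓘(ℝ, F)) p.2
    (mdifferentiableAt_fibreCoord hp) (mdifferentiable_totalSpaceMk (I := I) p.proj p.2) u
  refine hcomp.symm.trans ?_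
  rw [show (fun z : TotalSpace F V ↦ (trivializationAt F V q₀ z).2) ∘ TotalSpace.mk' F p.proj =
    (trivializationAt F V q₀).continuousLinearMapAt ℝ p.proj from
      funext (trivializationAt_eq_continuousLinearMapAt hp), ContinuousLinearMap.mfderiv_eq]
  rfl

theorem connector_verticalLift (cov : CovariantDerivative I F V) (p : TotalSpace F V)
    (u : V p.proj) : connector cov p (verticalLift I p u) = u := by
  have hp := FiberBundle.mem_baseSet_trivializationAt' (F := F) (E := V) p.proj
  change (trivializationAt F V p.proj).symmL ℝ p.proj (dfibre I F V p (verticalLift I p u))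
    + cov (FiberBundle.extend F p.2) p.proj (dproj I F V p (verticalLift I p u)) = u
  have hfibre : dfibre I F V p (verticalLift I p u) = _ := mfderiv_fibreCoord_verticalLift hp u
  rw [dproj_verticalLift, map_zero, add_zero, hfibre,
    Trivialization.symmL_continuousLinearMapAt _ hp]

theorem cov_constSection_add (cov : CovariantDerivative I F V)
    (hq : q ∈ (trivializationAt F V q₀).baseSet) (f g : F) :
    cov (constSection q₀ (f + g)) q = cov (constSection q₀ f) q + cov (constSection q₀ g) q := by
  rw [constSection_add]
  exact cov.isCovariantDerivativeOn.add (mdifferentiableAt_constSection hq f)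
    (mdifferentiableAt_constSection hq g)

theorem cov_constSection_smul (cov : CovariantDerivative I F V)
    (hq : q ∈ (trivializationAt F V q₀).baseSet) (c : ℝ) (f : F) :
    cov (constSection q₀ (c • f)) q = c • cov (constSection q₀ f) q := by
  rw [constSection_smul]
  exact cov.isCovariantDerivativeOn.smul_const c (mdifferentiableAt_constSection hq f)

theorem mfderiv_normSq_verticalLift [IsContMDiffRiemannianBundle I 1 F V]
    (p : TotalSpace F V) (u : V p.proj) :
    mfderiv (I.prod 𝓘(ℝ, F)) 𝓘(ℝ, ℝ) (fun z : TotalSpace F V ↦ inner ℝ z.2 z.2) p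
      (verticalLift I p u) = 2 * inner ℝ u p.2 := by
  have hcomp := mfderiv_comp_apply (I' := I.prod 𝓘(ℝ, F)) p.2 (mdifferentiableAt_normSq p)
    (mdifferentiable_totalSpaceMk (I := I) p.proj p.2) u
  refine hcomp.symm.trans ?_
  have hinner : HasFDerivAt (fun w : V p.proj ↦ inner ℝ w w)
      ((fderivInnerCLM ℝ (p.2, p.2)).comp ((ContinuousLinearMap.id ℝ (V p.proj)).prod
        (ContinuousLinearMap.id ℝ (V p.proj)))) p.2 :=
    (hasFDerivAt_id p.2).inner ℝ (hasFDerivAt_id p.2)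
  rw [show (fun z : TotalSpace F V ↦ inner ℝ z.2 z.2) ∘ TotalSpace.mk' F p.proj =
    fun w : V p.proj ↦ inner ℝ w w from rfl, mfderiv_eq_fderiv, hinner.fderiv]
  change inner ℝ p.2 u + inner ℝ u p.2 = 2 * inner ℝ u p.2
  rw [real_inner_comm, two_mul]

variable [FiniteDimensional ℝ F]

theorem eq_mfderiv_section_add_verticalLift (cov : CovariantDerivative I F V) {Y : ∀ x, V x}
    (hY : MDifferentiableAt I (I.prod 𝓘(ℝ, F)) (fun x ↦ TotalSpace.mk' F x (Y x)) q)
    (ξ : TangentSpace (I.prod 𝓘(ℝ, F)) (⟨q, Y q⟩ : TotalSpace F V)) :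
    ξ = mfderiv I (I.prod 𝓘(ℝ, F)) (fun x ↦ TotalSpace.mk' F x (Y x)) q (dproj I F V ⟨q, Y q⟩ ξ)
      + verticalLift I ⟨q, Y q⟩
        (connector cov ⟨q, Y q⟩ ξ - cov Y q (dproj I F V ⟨q, Y q⟩ ξ)) := by
  refine sub_eq_zero.1 (eq_zero_of_dproj_of_connector cov _ _ ?_ ?_)
  · rw [map_sub, map_add, dproj_mfderiv_section hY, dproj_verticalLift, add_zero, sub_self]
  · rw [map_sub, map_add, connector_mfderiv_section cov hY, connector_verticalLift,
      add_sub_cancel, sub_self]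

theorem connector_eq_of_mem_baseSet (cov : CovariantDerivative I F V) {p : TotalSpace F V}
    (hp : p.proj ∈ (trivializationAt F V q₀).baseSet) (ξ : TangentSpace (I.prod 𝓘(ℝ, F)) p) :
    connector cov p ξ = (trivializationAt F V q₀).symmL ℝ p.proj
        (mfderiv (I.prod 𝓘(ℝ, F)) 𝓘(ℝ, F)
          (fun z : TotalSpace F V ↦ (trivializationAt F V q₀ z).2) p ξ)
      + cov (constSection q₀ (trivializationAt F V q₀ p).2) p.proj (dproj I F V p ξ) := by
  obtain ⟨q, w⟩ := p
  obtain ⟨f, rfl⟩ : ∃ f, constSection q₀ f q = w := ⟨_, constSection_trivializationAt hp w⟩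
  have hY := mdifferentiableAt_constSection (I := I) (V := V) hp f
  have hcoord : mfderiv (I.prod 𝓘(ℝ, F)) 𝓘(ℝ, F)
      (fun z : TotalSpace F V ↦ (trivializationAt F V q₀ z).2) ⟨q, constSection q₀ f q⟩
      (mfderiv I (I.prod 𝓘(ℝ, F)) (fun x ↦ TotalSpace.mk' F x (constSection (V := V) q₀ f x)) q
        (dproj I F V ⟨q, constSection q₀ f q⟩ ξ)) = 0 := by
    have hcomp := mfderiv_comp_apply (I' := I.prod 𝓘(ℝ, F)) q (mdifferentiableAt_fibreCoord hp) hY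
      (dproj I F V ⟨q, constSection q₀ f q⟩ ξ)
    have hconst : (fun z : TotalSpace F V ↦ (trivializationAt F V q₀ z).2) ∘
        (fun x ↦ TotalSpace.mk' F x (constSection (V := V) q₀ f x)) =ᶠ[𝓝 q] fun _ ↦ f := by
      filter_upwards [(trivializationAt F V q₀).open_baseSet.mem_nhds hp] with x hx
        using trivializationAt_constSection hx f
    rw [hconst.mfderiv_eq, mfderiv_const] at hcomp
    exact hcomp.symm
  conv_rhs => enter [1, 2, 2]; rw [eq_mfderiv_section_add_verticalLift cov hY ξ]
  rw [map_add, hcoord, zero_add, mfderiv_fibreCoord_verticalLift hp,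
    Trivialization.symmL_continuousLinearMapAt _ hp, trivializationAt_constSection hp]
  exact (sub_add_cancel _ _).symm

theorem mfderiv_normSq [IsContMDiffRiemannianBundle I 1 F V]
    {cov : CovariantDerivative I F V} (hmetric : cov.IsMetricCompatible)
    (p : TotalSpace F V) (ξ : TangentSpace (I.prod 𝓘(ℝ, F)) p) :
    mfderiv (I.prod 𝓘(ℝ, F)) 𝓘(ℝ, ℝ) (fun z : TotalSpace F V ↦ inner ℝ z.2 z.2) p ξ
      = 2 * inner ℝ (connector cov p ξ) p.2 := by
  classical
  obtain ⟨q, w⟩ := p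
  obtain ⟨Y, hY, rfl⟩ : ∃ Y : ∀ x, V x,
      MDifferentiableAt I (I.prod 𝓘(ℝ, F)) (fun x ↦ TotalSpace.mk' F x (Y x)) q ∧ Y q = w :=
    ⟨FiberBundle.extend F w, FiberBundle.mdifferentiableAt_extend I F w,
      FiberBundle.extend_apply_self F w⟩
  set v : TangentSpace I q := dproj I F V ⟨q, Y q⟩ ξ
  have hsection : mfderiv (I.prod 𝓘(ℝ, F)) 𝓘(ℝ, ℝ) (fun z : TotalSpace F V ↦ inner ℝ z.2 z.2)
      ⟨q, Y q⟩ (mfderiv I (I.prod 𝓘(ℝ, F)) (fun x ↦ TotalSpace.mk' F x (Y x)) q v)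
      = 2 * inner ℝ (cov Y q v) (Y q) := by
    have hcompat := hmetric.mvfderiv_inner_eq (Function.update 0 q v) hY hY
    simp only [Function.update_self, real_inner_comm (cov Y q v), ← two_mul] at hcompat
    exact (mfderiv_comp_apply (I' := I.prod 𝓘(ℝ, F)) q (mdifferentiableAt_normSq _) hY v).symm.trans
      hcompat
  conv_lhs => rw [eq_mfderiv_section_add_verticalLift cov hY ξ]
  rw [map_add, hsection, mfderiv_normSq_verticalLift]
  change 2 * inner ℝ (cov Y q v) (Y q) + 2 * inner ℝ (connector cov _ ξ - cov Y q v) (Y q)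
    = 2 * inner ℝ (connector cov ⟨q, Y q⟩ ξ) (Y q)
  rw [inner_sub_left]
  ring

end Connector

section AlongCurves

variable {B : Type*} [NormedAddCommGroup B] [NormedSpace ℝ B]
  {H : Type*} [TopologicalSpace H] {I : ModelWithCorners ℝ B H}
  {N : Type*} [TopologicalSpace N] [ChartedSpace H N]
  {F : Type*} [NormedAddCommGroup F] [NormedSpace ℝ F]
  {V : N → Type*} [TopologicalSpace (TotalSpace F V)]
  [∀ x, NormedAddCommGroup (V x)] [FiberBundle F V]
  {γ : ℝ → N} {t : ℝ} {q₀ : N}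

variable (F) in
/-- The curve in the total space given by a section along the curve `γ` in the base. -/
abbrev sectionCurve {γ : ℝ → N} (f : ∀ t, V (γ t)) (t : ℝ) : TotalSpace F V := ⟨γ t, f t⟩

theorem dproj_mfderiv_curve {α : ℝ → TotalSpace F V}
    (hα : MDifferentiableAt 𝓘(ℝ, ℝ) (I.prod 𝓘(ℝ, F)) α t) :
    dproj I F V (α t) (mfderiv 𝓘(ℝ, ℝ) (I.prod 𝓘(ℝ, F)) α t (1 : ℝ))
      = mfderiv 𝓘(ℝ, ℝ) I (fun s ↦ (α s).proj) t (1 : ℝ) :=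
  (mfderiv_comp_apply (I' := I.prod 𝓘(ℝ, F)) t
    (g := (TotalSpace.proj : TotalSpace F V → N)) (mdifferentiableAt_proj V) hα (1 : ℝ)).symm

variable [∀ x, InnerProductSpace ℝ (V x)] [VectorBundle ℝ F V]

theorem norm_covDerivAlong_congr {cov : CovariantDerivative I F V} {α β : ℝ → TotalSpace F V}
    (h : α =ᶠ[𝓝 t] β) : ‖covDerivAlong cov α t‖ = ‖covDerivAlong cov β t‖ := by
  have hpoint : ∀ p p' : TotalSpace F V, p = p' → ∀ ξ : B × F,
      ‖connector cov p ξ‖ = ‖connector cov p' ξ‖ := by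
    rintro p _ rfl ξ
    rfl
  have hvelocity := congrArg (fun L : ℝ →L[ℝ] B × F ↦ L 1)
    (h.mfderiv_eq (I := 𝓘(ℝ, ℝ)) (I' := I.prod 𝓘(ℝ, F)))
  exact (hpoint _ _ h.self_of_nhds _).trans (congrArg (fun ξ ↦ ‖connector cov (β t) ξ‖) hvelocity)

variable [ContMDiffVectorBundle 1 F V I]

theorem mdifferentiableAt_sectionCurve_iff {f : ∀ s, V (γ s)}
    (hq : γ t ∈ (trivializationAt F V q₀).baseSet) :
    MDifferentiableAt 𝓘(ℝ, ℝ) (I.prod 𝓘(ℝ, F)) (sectionCurve F f) t ↔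
      MDifferentiableAt 𝓘(ℝ, ℝ) I γ t ∧
        DifferentiableAt ℝ (fun s ↦ (trivializationAt F V q₀ ⟨γ s, f s⟩).2) t := by
  rw [(trivializationAt F V q₀).mdifferentiableAt_totalSpace_iff I,
    mdifferentiableAt_iff_differentiableAt (f := fun s ↦ (trivializationAt F V q₀ ⟨γ s, f s⟩).2)]
  rwa [Trivialization.mem_source]

theorem hasDerivAt_fibreCoord_add {f g : ∀ s, V (γ s)}
    (hq : γ t ∈ (trivializationAt F V q₀).baseSet)
    (hf : MDifferentiableAt 𝓘(ℝ, ℝ) (I.prod 𝓘(ℝ, F)) (sectionCurve F f) t)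
    (hg : MDifferentiableAt 𝓘(ℝ, ℝ) (I.prod 𝓘(ℝ, F)) (sectionCurve F g) t) :
    HasDerivAt (fun s ↦ (trivializationAt F V q₀ (sectionCurve F (fun s ↦ f s + g s) s)).2)
      (deriv (fun s ↦ (trivializationAt F V q₀ (sectionCurve F f s)).2) t
        + deriv (fun s ↦ (trivializationAt F V q₀ (sectionCurve F g s)).2) t) t := by
  obtain ⟨hγ, hf'⟩ := (mdifferentiableAt_sectionCurve_iff hq).1 hf
  obtain ⟨-, hg'⟩ := (mdifferentiableAt_sectionCurve_iff hq).1 hg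
  refine (hf'.hasDerivAt.add hg'.hasDerivAt).congr_of_eventuallyEq ?_
  filter_upwards [hγ.continuousAt.preimage_mem_nhds
    ((trivializationAt F V q₀).open_baseSet.mem_nhds hq)] with s hs
  simp only [Pi.add_apply, trivializationAt_eq_continuousLinearMapAt hs, map_add]

theorem hasDerivAt_fibreCoord_smul {c : ℝ → ℝ} {f : ∀ s, V (γ s)}
    (hq : γ t ∈ (trivializationAt F V q₀).baseSet) (hc : DifferentiableAt ℝ c t)
    (hf : MDifferentiableAt 𝓘(ℝ, ℝ) (I.prod 𝓘(ℝ, F)) (sectionCurve F f) t) :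
    HasDerivAt (fun s ↦ (trivializationAt F V q₀ (sectionCurve F (fun s ↦ c s • f s) s)).2)
      (c t • deriv (fun s ↦ (trivializationAt F V q₀ (sectionCurve F f s)).2) t
        + deriv c t • (trivializationAt F V q₀ (sectionCurve F f t)).2) t := by
  obtain ⟨hγ, hf'⟩ := (mdifferentiableAt_sectionCurve_iff hq).1 hf
  refine (hc.hasDerivAt.smul hf'.hasDerivAt).congr_of_eventuallyEq ?_
  filter_upwards [hγ.continuousAt.preimage_mem_nhds
    ((trivializationAt F V q₀).open_baseSet.mem_nhds hq)] with s hs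
  simp only [Pi.smul_apply', trivializationAt_eq_continuousLinearMapAt hs, map_smul]

theorem mdifferentiableAt_sectionCurve_add {f g : ∀ s, V (γ s)}
    (hf : MDifferentiableAt 𝓘(ℝ, ℝ) (I.prod 𝓘(ℝ, F)) (sectionCurve F f) t)
    (hg : MDifferentiableAt 𝓘(ℝ, ℝ) (I.prod 𝓘(ℝ, F)) (sectionCurve F g) t) :
    MDifferentiableAt 𝓘(ℝ, ℝ) (I.prod 𝓘(ℝ, F)) (sectionCurve F fun s ↦ f s + g s) t :=
  have hq := FiberBundle.mem_baseSet_trivializationAt' (F := F) (E := V) (γ t)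
  (mdifferentiableAt_sectionCurve_iff hq).2
    ⟨((mdifferentiableAt_sectionCurve_iff hq).1 hf).1,
      (hasDerivAt_fibreCoord_add hq hf hg).differentiableAt⟩

theorem mdifferentiableAt_sectionCurve_smul {c : ℝ → ℝ} {f : ∀ s, V (γ s)}
    (hc : DifferentiableAt ℝ c t)
    (hf : MDifferentiableAt 𝓘(ℝ, ℝ) (I.prod 𝓘(ℝ, F)) (sectionCurve F f) t) :
    MDifferentiableAt 𝓘(ℝ, ℝ) (I.prod 𝓘(ℝ, F)) (sectionCurve F fun s ↦ c s • f s) t :=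
  have hq := FiberBundle.mem_baseSet_trivializationAt' (F := F) (E := V) (γ t)
  (mdifferentiableAt_sectionCurve_iff hq).2
    ⟨((mdifferentiableAt_sectionCurve_iff hq).1 hf).1,
      (hasDerivAt_fibreCoord_smul hq hc hf).differentiableAt⟩

variable [FiniteDimensional ℝ F]

theorem hasDerivAt_inner_self [IsContMDiffRiemannianBundle I 1 F V]
    {cov : CovariantDerivative I F V}
    (hmetric : cov.IsMetricCompatible) {α : ℝ → TotalSpace F V}
    (hα : MDifferentiableAt 𝓘(ℝ, ℝ) (I.prod 𝓘(ℝ, F)) α t) :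
    HasDerivAt (fun s ↦ inner ℝ (α s).2 (α s).2)
      (2 * inner ℝ (covDerivAlong cov α t) (α t).2) t := by
  have hcomp : HasFDerivAt (fun s ↦ inner ℝ (α s).2 (α s).2 : ℝ → ℝ) (_ : ℝ →L[ℝ] ℝ) t :=
    hasMFDerivAt_iff_hasFDerivAt.1
      (HasMFDerivAt.comp t (mdifferentiableAt_normSq (α t)).hasMFDerivAt hα.hasMFDerivAt)
  convert hcomp.hasDerivAt using 1
  exact (mfderiv_normSq hmetric (α t) _).symm

theorem covDerivAlong_eq (cov : CovariantDerivative I F V) {α : ℝ → TotalSpace F V}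
    (hq : (α t).proj ∈ (trivializationAt F V q₀).baseSet)
    (hα : MDifferentiableAt 𝓘(ℝ, ℝ) (I.prod 𝓘(ℝ, F)) α t) :
    covDerivAlong cov α t = (trivializationAt F V q₀).symmL ℝ (α t).proj
        (deriv (fun s ↦ (trivializationAt F V q₀ (α s)).2) t)
      + cov (constSection q₀ (trivializationAt F V q₀ (α t)).2) (α t).proj
        (mfderiv 𝓘(ℝ, ℝ) I (fun s ↦ (α s).proj) t (1 : ℝ)) := by
  have hcoord : (mfderiv (I.prod 𝓘(ℝ, F)) 𝓘(ℝ, F)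
      (fun z : TotalSpace F V ↦ (trivializationAt F V q₀ z).2) (α t)
        (mfderiv 𝓘(ℝ, ℝ) (I.prod 𝓘(ℝ, F)) α t (1 : ℝ)) : F)
      = deriv (fun s ↦ (trivializationAt F V q₀ (α s)).2) t := by
    refine (mfderiv_comp_apply (I' := I.prod 𝓘(ℝ, F)) t
      (mdifferentiableAt_fibreCoord hq) hα (1 : ℝ)).symm.trans ?_
    change mfderiv 𝓘(ℝ, ℝ) 𝓘(ℝ, F) (fun s ↦ (trivializationAt F V q₀ (α s)).2) t (1 : ℝ) = _
    rw [mfderiv_eq_fderiv]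
    rfl
  rw [covDerivAlong, connector_eq_of_mem_baseSet cov hq, dproj_mfderiv_curve hα]
  congr 2

theorem covDerivAlong_add (cov : CovariantDerivative I F V) {f g : ∀ s, V (γ s)}
    (hf : MDifferentiableAt 𝓘(ℝ, ℝ) (I.prod 𝓘(ℝ, F)) (sectionCurve F f) t)
    (hg : MDifferentiableAt 𝓘(ℝ, ℝ) (I.prod 𝓘(ℝ, F)) (sectionCurve F g) t) :
    covDerivAlong cov (sectionCurve F fun s ↦ f s + g s) t
      = covDerivAlong cov (sectionCurve F f) t + covDerivAlong cov (sectionCurve F g) t := by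
  have hq := FiberBundle.mem_baseSet_trivializationAt' (F := F) (E := V) (γ t)
  rw [covDerivAlong_eq cov hq (mdifferentiableAt_sectionCurve_add hf hg),
    covDerivAlong_eq cov hq hf, covDerivAlong_eq cov hq hg,
    (hasDerivAt_fibreCoord_add hq hf hg).deriv]
  simp only [trivializationAt_eq_continuousLinearMapAt hq, map_add, cov_constSection_add cov hq,
    _root_.add_apply]
  abel

theorem covDerivAlong_smul (cov : CovariantDerivative I F V) {c : ℝ → ℝ} {f : ∀ s, V (γ s)}
    (hc : DifferentiableAt ℝ c t)
    (hf : MDifferentiableAt 𝓘(ℝ, ℝ) (I.prod 𝓘(ℝ, F)) (sectionCurve F f) t) :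
    covDerivAlong cov (sectionCurve F fun s ↦ c s • f s) t
      = c t • covDerivAlong cov (sectionCurve F f) t + deriv c t • f t := by
  have hq := FiberBundle.mem_baseSet_trivializationAt' (F := F) (E := V) (γ t)
  rw [covDerivAlong_eq cov hq (mdifferentiableAt_sectionCurve_smul hc hf),
    covDerivAlong_eq cov hq hf, (hasDerivAt_fibreCoord_smul hq hc hf).deriv]
  simp only [trivializationAt_eq_continuousLinearMapAt hq, map_add, map_smul,
    cov_constSection_smul cov hq, _root_.smul_apply,
    Trivialization.symmL_continuousLinearMapAt _ hq]
  module

end AlongCurves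

section Continuity

variable {B : Type*} [NormedAddCommGroup B] [NormedSpace ℝ B]
  {H : Type*} [TopologicalSpace H] {I : ModelWithCorners ℝ B H}
  {N : Type*} [TopologicalSpace N] [ChartedSpace H N]
  {F : Type*} [NormedAddCommGroup F] [NormedSpace ℝ F]
  {V : N → Type*} [TopologicalSpace (TotalSpace F V)]
  [∀ x, NormedAddCommGroup (V x)] [∀ x, InnerProductSpace ℝ (V x)]
  [FiberBundle F V] [VectorBundle ℝ F V] {q₀ : N}

/-- The connection form of `∇` in the trivialization around `q₀`: the coordinates of `∇_v s` for
the section `s` with constant coordinate `f`, as a linear function of `f`. It is assembled from a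
basis of `F` because `f ↦ ∇_v s` is linear only over the domain of the trivialization. -/
def connectionForm (cov : CovariantDerivative I F V) [FiniteDimensional ℝ F] (q₀ : N)
    (v : TangentBundle I N) : F →L[ℝ] F :=
  ∑ i, ((Module.finBasis ℝ F).coord i).toContinuousLinearMap.smulRight
    (trivializationAt F V q₀ ⟨v.proj, cov (constSection q₀ (Module.finBasis ℝ F i)) v.proj v.2⟩).2

theorem continuous_dproj [IsManifold I 1 N] [ContMDiffVectorBundle 1 F V I] :
    Continuous (fun ξ : TangentBundle (I.prod 𝓘(ℝ, F)) (TotalSpace F V) ↦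
      (⟨ξ.proj.proj, dproj I F V ξ.proj ξ.2⟩ : TangentBundle I N)) :=
  (contMDiff_proj (n := 1) (IB := I) (F := F) V).continuous_tangentMap le_rfl

theorem continuousAt_mfderiv_fibreCoord [IsManifold I 1 N] [ContMDiffVectorBundle 1 F V I]
    {ξ₀ : TangentBundle (I.prod 𝓘(ℝ, F)) (TotalSpace F V)}
    (h : ξ₀.proj.proj ∈ (trivializationAt F V q₀).baseSet) :
    ContinuousAt (fun ξ : TangentBundle (I.prod 𝓘(ℝ, F)) (TotalSpace F V) ↦
      (mfderiv (I.prod 𝓘(ℝ, F)) 𝓘(ℝ, F)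
        (fun z : TotalSpace F V ↦ (trivializationAt F V q₀ z).2) ξ.proj ξ.2 : F)) ξ₀ := by
  set e := trivializationAt F V q₀
  have hcoord : ContMDiffOn (I.prod 𝓘(ℝ, F)) 𝓘(ℝ, F) 1 (fun z : TotalSpace F V ↦ (e z).2)
      e.source := fun z hz ↦ (e.contMDiffOn (IB := I) (n := 1) z hz).snd
  have hsource : (TotalSpace.proj ⁻¹' e.source :
      Set (TangentBundle (I.prod 𝓘(ℝ, F)) (TotalSpace F V))) ∈ 𝓝 ξ₀ :=
    (e.open_source.preimage (FiberBundle.continuous_proj _ _)).mem_nhds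
      (by rwa [mem_preimage, Trivialization.mem_source])
  have htangent := (hcoord.continuousOn_tangentMapWithin le_rfl
    e.open_source.uniqueMDiffOn).continuousAt hsource
  refine ((contMDiff_snd_tangentBundle_modelSpace (n := 0) F
    𝓘(ℝ, F)).continuous.continuousAt.comp htangent).congr ?_
  filter_upwards [hsource] with ξ hξ
  simp only [Function.comp, tangentMapWithin]
  rw [mfderivWithin_of_isOpen e.open_source hξ]

/-- A connection with continuous coefficients: `∇_v s` depends continuously on the tangent vector
`v` for every section `s` with constant coordinates in a trivialization. -/
def IsContinuousConnection [IsManifold I 1 N] (cov : CovariantDerivative I F V) : Prop :=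
  ∀ (q₀ : N) (f : F), ContinuousOn (fun v : TangentBundle I N ↦
    TotalSpace.mk' F v.proj (cov (constSection q₀ f) v.proj v.2))
    (TotalSpace.proj ⁻¹' (trivializationAt F V q₀).baseSet)

theorem isContinuousConnection_of_contMDiff [FiniteDimensional ℝ B] [T2Space N]
    [IsManifold I ∞ N] [ContMDiffVectorBundle ∞ F V I] {cov : CovariantDerivative I F V}
    (hcov : cov.ContMDiffCovariantDerivative ∞) : IsContinuousConnection cov := by
  intro q₀ f v₀ hv₀
  have hopen := (trivializationAt F V q₀).open_baseSet
  obtain ⟨ρ, -, hρ⟩ := (SmoothBumpFunction.nhds_basis_tsupport (I := I) v₀.proj).mem_iff.1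
    (hopen.mem_nhds hv₀)
  have hsmooth : ContMDiff I (I.prod 𝓘(ℝ, F)) ∞
      (fun x ↦ TotalSpace.mk' F x ((⇑ρ • constSection (V := V) q₀ f) x)) :=
    ContMDiffOn.smul_section_of_tsupport ρ.contMDiff.contMDiffOn hopen hρ
      (contMDiffOn_constSection q₀ f)
  have hproj : Continuous (TotalSpace.proj : TangentBundle I N → N) :=
    FiberBundle.continuous_proj B (TangentSpace I : N → Type _)
  have hglobal : Continuous (fun v : TangentBundle I N ↦
      TotalSpace.mk' F v.proj (cov (⇑ρ • constSection q₀ f) v.proj v.2)) :=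
    (ContMDiff.clm_bundle_apply
      ((contMDiffOn_univ.1 (hcov.contMDiff.contMDiff hsmooth.contMDiffOn)).comp
        (contMDiff_proj (IB := I) (F := B) (TangentSpace I : N → Type _)))
      (contMDiff_id : ContMDiff I.tangent I.tangent ∞
        (fun v : TangentBundle I N ↦ TotalSpace.mk' B v.proj v.2))).continuous
  refine (hglobal.continuousAt.congr ?_).continuousWithinAt
  filter_upwards [hproj.continuousAt.eventually ρ.eventuallyEq_one.eventually_nhds,
    hproj.continuousAt.eventually (hopen.mem_nhds hv₀)] with v hv hvS
  have hlocal : cov (⇑ρ • constSection q₀ f) v.proj = cov (constSection q₀ f) v.proj := by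
    refine cov.isCovariantDerivativeOnUniv.congr_of_eventuallyEq
      ((hsmooth _).mdifferentiableAt (by simp)) (mdifferentiableAt_constSection hvS f)
      univ_mem ?_
    filter_upwards [hv] with y hy
    simp [hy]
  exact congrArg (fun L ↦ TotalSpace.mk' F v.proj (L v.2)) hlocal

variable [ContMDiffVectorBundle 1 F V I] [FiniteDimensional ℝ F]

theorem connectionForm_apply (cov : CovariantDerivative I F V) {v : TangentBundle I N}
    (hv : v.proj ∈ (trivializationAt F V q₀).baseSet) (f : F) :
    connectionForm cov q₀ v f
      = (trivializationAt F V q₀ ⟨v.proj, cov (constSection q₀ f) v.proj v.2⟩).2 := by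
  let L : F →ₗ[ℝ] F :=
    { toFun := fun f ↦ (trivializationAt F V q₀ ⟨v.proj, cov (constSection q₀ f) v.proj v.2⟩).2
      map_add' := fun f g ↦ by
        simp only [cov_constSection_add cov hv, _root_.add_apply,
          trivializationAt_eq_continuousLinearMapAt hv, map_add]
      map_smul' := fun c f ↦ by
        simp only [cov_constSection_smul cov hv, _root_.smul_apply,
          trivializationAt_eq_continuousLinearMapAt hv, map_smul, RingHom.id_apply] }
  change _ = L f
  conv_rhs => rw [← (Module.finBasis ℝ F).sum_repr f, map_sum]
  simp only [connectionForm, _root_.sum_apply, map_smul]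
  rfl

theorem trivializationAt_connector (cov : CovariantDerivative I F V)
    {ξ : TangentBundle (I.prod 𝓘(ℝ, F)) (TotalSpace F V)}
    (hξ : ξ.proj.proj ∈ (trivializationAt F V q₀).baseSet) :
    (trivializationAt F V q₀ ⟨ξ.proj.proj, connector cov ξ.proj ξ.2⟩).2
      = (show F from mfderiv (I.prod 𝓘(ℝ, F)) 𝓘(ℝ, F)
          (fun z : TotalSpace F V ↦ (trivializationAt F V q₀ z).2) ξ.proj ξ.2)
        + connectionForm cov q₀ ⟨ξ.proj.proj, dproj I F V ξ.proj ξ.2⟩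
          (trivializationAt F V q₀ ξ.proj).2 := by
  rw [connectionForm_apply cov (v := ⟨ξ.proj.proj, dproj I F V ξ.proj ξ.2⟩) hξ,
    connector_eq_of_mem_baseSet cov hξ, trivializationAt_eq_continuousLinearMapAt hξ, map_add,
    trivializationAt_eq_continuousLinearMapAt hξ (cov _ _ _)]
  exact congrArg (· + _) (Trivialization.continuousLinearMapAt_symmL _ hξ _)

variable [IsManifold I 1 N]

theorem continuousOn_connectionForm {cov : CovariantDerivative I F V}
    (hcov : IsContinuousConnection cov) (q₀ : N) :
    ContinuousOn (connectionForm cov q₀)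
      (TotalSpace.proj ⁻¹' (trivializationAt F V q₀).baseSet) := by
  rw [continuousOn_clm_apply]
  intro f
  have hcoord := (trivializationAt F V q₀).continuousOn.comp (hcov q₀ f) fun v hv ↦ by
    rwa [Trivialization.mem_source]
  exact (continuous_snd.comp_continuousOn hcoord).congr fun v hv ↦ connectionForm_apply cov hv f

theorem continuous_connector {cov : CovariantDerivative I F V}
    (hcov : IsContinuousConnection cov) :
    Continuous (fun ξ : TangentBundle (I.prod 𝓘(ℝ, F)) (TotalSpace F V) ↦
      TotalSpace.mk' F ξ.proj.proj (connector cov ξ.proj ξ.2)) := by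
  refine continuous_iff_continuousAt.2 fun ξ₀ ↦ ?_
  set e := trivializationAt F V ξ₀.proj.proj
  have hmem : ξ₀.proj.proj ∈ e.baseSet := FiberBundle.mem_baseSet_trivializationAt' _
  have hproj : Continuous (TotalSpace.proj :
      TangentBundle (I.prod 𝓘(ℝ, F)) (TotalSpace F V) → TotalSpace F V) :=
    FiberBundle.continuous_proj _ _
  have hbase : Continuous (fun ξ : TangentBundle (I.prod 𝓘(ℝ, F)) (TotalSpace F V) ↦ ξ.proj.proj) :=
    (FiberBundle.continuous_proj F V).comp hproj
  have hbaseSet := hbase.continuousAt.preimage_mem_nhds (e.open_baseSet.mem_nhds hmem)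
  have hform : ContinuousAt (fun ξ : TangentBundle (I.prod 𝓘(ℝ, F)) (TotalSpace F V) ↦
      connectionForm cov ξ₀.proj.proj ⟨ξ.proj.proj, dproj I F V ξ.proj ξ.2⟩) ξ₀ :=
    ((continuousOn_connectionForm hcov ξ₀.proj.proj).comp continuous_dproj.continuousOn
      fun _ hξ ↦ hξ).continuousAt hbaseSet
  have hcoord : ContinuousAt (fun ξ : TangentBundle (I.prod 𝓘(ℝ, F)) (TotalSpace F V) ↦
      (e ξ.proj).2) ξ₀ :=
    ((continuous_snd.comp_continuousOn e.continuousOn).comp hproj.continuousOn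
      fun _ hξ ↦ e.mem_source.2 hξ).continuousAt hbaseSet
  refine (FiberBundle.continuousAt_totalSpace _ _).2 ⟨hbase.continuousAt, ?_⟩
  refine ((continuousAt_mfderiv_fibreCoord hmem).add (hform.clm_apply hcoord)).congr ?_
  filter_upwards [hbaseSet] with ξ hξ
  exact (trivializationAt_connector cov hξ).symm

theorem continuous_inner_dproj_add_inner_connector
    [RiemannianBundle (fun x : N ↦ TangentSpace I x)]
    [IsContinuousRiemannianBundle B (fun x : N ↦ TangentSpace I x)]
    [IsContinuousRiemannianBundle F V] {cov : CovariantDerivative I F V}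
    (hcov : IsContinuousConnection cov) :
    Continuous (fun ξ : TangentBundle (I.prod 𝓘(ℝ, F)) (TotalSpace F V) ↦
      inner ℝ (dproj I F V ξ.proj ξ.2) (dproj I F V ξ.proj ξ.2)
        + inner ℝ (connector cov ξ.proj ξ.2) (connector cov ξ.proj ξ.2)) :=
  (Continuous.inner_bundle (F := B) (E := fun x : N ↦ TangentSpace I x)
    continuous_dproj continuous_dproj).add
    ((continuous_connector hcov).inner_bundle (continuous_connector hcov))

end Continuity

section PiecewiseC1

variable {E : Type*} [NormedAddCommGroup E] [NormedSpace ℝ E]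
  {H : Type*} [TopologicalSpace H] {I : ModelWithCorners ℝ E H}
  {M : Type*} [TopologicalSpace M] [ChartedSpace H M] {γ : ℝ → M} {a b : ℝ}

theorem PiecewiseOn.continuousOn (h : PiecewiseOn (fun s s' ↦ ContinuousOn γ (Icc s s')) a b)
    (hab : a < b) : ContinuousOn γ (Icc a b) :=
  h.rel (R := fun s s' ↦ ContinuousOn γ (Icc s s')) hab fun s t u hst htu hs hu ↦ by
    rw [← Icc_union_Icc_eq_Icc hst.le htu.le]
    exact hs.union_of_isClosed hu isClosed_Icc isClosed_Icc

theorem continuousOn_velocity [IsManifold I 1 M] (hab : a < b)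
    (hγ : ContMDiffOn 𝓘(ℝ, ℝ) I 1 γ (Icc a b)) :
    ContinuousOn (fun t ↦ (⟨γ t, mfderivWithin 𝓘(ℝ, ℝ) I γ (Icc a b) t (1 : ℝ)⟩ :
      TangentBundle I M)) (Icc a b) := by
  let unitField : ℝ → TangentBundle 𝓘(ℝ, ℝ) ℝ := fun t ↦ ⟨t, (1 : ℝ)⟩
  have hunit : Continuous unitField :=
    ((contMDiff_vectorSpace_iff_contDiff (V := fun _ : ℝ ↦ (1 : ℝ)) (n := 0)).2
      contDiff_const).continuous
  exact ContinuousOn.comp (f := unitField) (hγ.continuousOn_tangentMapWithin le_rfl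
    (uniqueMDiffOn_iff_uniqueDiffOn.2 (uniqueDiffOn_Icc hab))) hunit.continuousOn fun t ht ↦ ht

variable (I) in
/-- `γ` is piecewise `C¹` on `[a, b]`, with one-sided derivatives at the corners. -/
def IsPiecewiseC1 (γ : ℝ → M) (a b : ℝ) : Prop :=
  PiecewiseOn (fun s s' ↦ ContMDiffOn 𝓘(ℝ, ℝ) I 1 γ (Icc s s')) a b

namespace IsPiecewiseC1

theorem of_contMDiffOn (h : ContMDiffOn 𝓘(ℝ, ℝ) I 1 γ (Icc a b)) : IsPiecewiseC1 I γ a b :=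
  .of_forall fun _ _ _ hsub ↦ h.mono hsub

theorem continuousOn (h : IsPiecewiseC1 I γ a b) (hab : a < b) : ContinuousOn γ (Icc a b) :=
  PiecewiseOn.continuousOn (h.mono fun _ _ _ _ hs ↦ ContMDiffOn.continuousOn hs) hab

theorem mdifferentiableAt (h : IsPiecewiseC1 I γ a b) :
    ∀ᶠ t in cofinite, t ∈ Icc a b → MDifferentiableAt 𝓘(ℝ, ℝ) I γ t := by
  filter_upwards [h.eventually_cofinite] with t ht htI
  obtain ⟨s, s', hts, -, hs⟩ := ht htI
  exact (hs.contMDiffAt (Icc_mem_nhds hts.1 hts.2)).mdifferentiableAt one_ne_zero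

end IsPiecewiseC1

end PiecewiseC1

section LinearODE

variable {F : Type*} [NormedAddCommGroup F] [NormedSpace ℝ F] [CompleteSpace F]

theorem exists_contDiffOn_linear_ode {a b : ℝ} (hab : a < b) {A : ℝ → F →L[ℝ] F}
    (hA : ContinuousOn A (Icc a b)) {M : ℝ} (hM : ∀ t ∈ Icc a b, ‖A t‖ ≤ M)
    (hlen : M * (b - a) ≤ 1 / 2) {t₀ : ℝ} (ht₀ : t₀ ∈ Icc a b) (x₀ : F) :
    ∃ y : ℝ → F, y t₀ = x₀ ∧ ContDiffOn ℝ 1 y (Icc a b) ∧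
      ∀ t ∈ Ioo a b, HasDerivAt y (A t (y t)) t := by
  obtain ⟨y, hy₀, hy⟩ := exists_linear_ode hA hM hlen ht₀ x₀
  have hyc : ContinuousOn y (Icc a b) := fun t ht ↦ (hy t ht).continuousWithinAt
  refine ⟨y, hy₀, ?_, fun t ht ↦ (hy t (Ioo_subset_Icc_self ht)).hasDerivAt
    (Icc_mem_nhds ht.1 ht.2)⟩
  rw [← zero_add 1, contDiffOn_succ_iff_derivWithin (uniqueDiffOn_Icc hab)]
  refine ⟨fun t ht ↦ (hy t ht).differentiableWithinAt, by simp, contDiffOn_zero.2 ?_⟩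
  exact (hA.clm_apply hyc).congr fun t ht ↦ (hy t ht).derivWithin (uniqueDiffOn_Icc hab t ht)

theorem exists_nhdsWithin_linear_ode {a b t₀ : ℝ} (ht₀ : t₀ ∈ Icc a b) {A : ℝ → F →L[ℝ] F}
    {W : Set ℝ} (hW : W ∈ 𝓝[Icc a b] t₀) (hA : ContinuousOn A (Icc a b ∩ W)) :
    ∃ U ∈ 𝓝[Icc a b] t₀, ∀ s s', s < s' → Icc s s' ⊆ Icc a b → Icc s s' ⊆ U →
      ∀ t₁ ∈ Icc s s', ∀ x₀ : F, ∃ y : ℝ → F, y t₁ = x₀ ∧ ContDiffOn ℝ 1 y (Icc s s') ∧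
        ∀ t ∈ Ioo s s', HasDerivAt y (A t (y t)) t := by
  set M := ‖A t₀‖ + 1
  have hM : 0 < M := by positivity
  have hbound : ∀ᶠ t in 𝓝[Icc a b] t₀, ‖A t‖ ≤ M := by
    have hcont : ContinuousWithinAt A (Icc a b) t₀ :=
      (hA t₀ ⟨ht₀, mem_of_mem_nhdsWithin ht₀ hW⟩).mono_of_mem_nhdsWithin
        (inter_mem self_mem_nhdsWithin hW)
    exact (hcont.norm.eventually (Iio_mem_nhds (lt_add_one ‖A t₀‖))).mono fun _ ↦ le_of_lt
  refine ⟨_, inter_mem (inter_mem hW hbound)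
    (mem_nhdsWithin_of_mem_nhds (Metric.ball_mem_nhds t₀ (ε := 1 / (4 * M)) (by positivity))),
    fun s s' hlt hsub hU t₁ ht₁ x₀ ↦ ?_⟩
  refine exists_contDiffOn_linear_ode hlt (hA.mono fun t ht ↦ ⟨hsub ht, (hU ht).1.1⟩)
    (fun t ht ↦ (hU ht).1.2) ?_ ht₁ x₀
  have hs := abs_lt.1 (Metric.mem_ball.1 (hU (left_mem_Icc.2 hlt.le)).2)
  have hs' := abs_lt.1 (Metric.mem_ball.1 (hU (right_mem_Icc.2 hlt.le)).2)
  calc M * (s' - s) ≤ M * (2 * (1 / (4 * M))) := by gcongr; linarith [hs.1, hs'.2]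
    _ = 1 / 2 := by field_simp; norm_num

end LinearODE

section ParallelSections

variable {B : Type*} [NormedAddCommGroup B] [NormedSpace ℝ B]
  {H : Type*} [TopologicalSpace H] {I : ModelWithCorners ℝ B H}
  {N : Type*} [TopologicalSpace N] [ChartedSpace H N]
  {F : Type*} [NormedAddCommGroup F] [NormedSpace ℝ F]
  {V : N → Type*} [TopologicalSpace (TotalSpace F V)]
  [∀ x, NormedAddCommGroup (V x)] [∀ x, InnerProductSpace ℝ (V x)]
  [FiberBundle F V] [VectorBundle ℝ F V]
  {cov : CovariantDerivative I F V} {γ : ℝ → N} {a b c : ℝ} {f g : ∀ t, V (γ t)}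

variable (cov) in
/-- The section `f` along `γ` is piecewise `C¹` and parallel on `[a, b]`. -/
def IsParallelSection (f : ∀ t, V (γ t)) (a b : ℝ) : Prop :=
  PiecewiseOn (fun s s' ↦ ContMDiffOn 𝓘(ℝ, ℝ) (I.prod 𝓘(ℝ, F)) 1 (sectionCurve F f) (Icc s s') ∧
    ∀ t ∈ Ioo s s', covDerivAlong cov (sectionCurve F f) t = 0) a b

namespace IsParallelSection

theorem isPiecewiseC1 (hf : IsParallelSection cov f a b) :
    IsPiecewiseC1 (I.prod 𝓘(ℝ, F)) (sectionCurve F f) a b :=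
  hf.mono fun _ _ _ _ hs ↦ hs.1

theorem covDerivAlong_eq_zero (hf : IsParallelSection cov f a b) :
    ∀ᶠ t in cofinite, t ∈ Icc a b → covDerivAlong cov (sectionCurve F f) t = 0 := by
  filter_upwards [hf.eventually_cofinite] with t ht htI
  obtain ⟨s, s', hts, -, hs⟩ := ht htI
  exact hs.2 t hts

theorem congr (hf : IsParallelSection cov f a b) (h : ∀ t ∈ Icc a b, f t = g t) :
    IsParallelSection cov g a b := by
  have hcurve : ∀ t ∈ Icc a b, sectionCurve F g t = sectionCurve F f t := fun t ht ↦
    congrArg (TotalSpace.mk' F (γ t)) (h t ht).symm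
  refine hf.mono fun s s' _ hsub hs ↦
    ⟨hs.1.congr fun t ht ↦ hcurve t (hsub ht), fun t ht ↦ ?_⟩
  have heq : sectionCurve F g =ᶠ[𝓝 t] sectionCurve F f := by
    filter_upwards [Icc_mem_nhds ht.1 ht.2] with r hr using hcurve r (hsub hr)
  rw [← norm_eq_zero, norm_covDerivAlong_congr heq, hs.2 t ht, norm_zero]

theorem exists_glue (hf : IsParallelSection cov f a b) (hg : IsParallelSection cov g b c)
    (hfg : f b = g b) : ∃ k : ∀ t, V (γ t), (∀ t ≤ b, k t = f t) ∧ (∀ t ≥ b, k t = g t) ∧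
      IsParallelSection cov k a c := by
  obtain ⟨k, hleft, hright⟩ := Sasaki.exists_glue hfg
  exact ⟨k, hleft, hright, (hf.congr fun t ht ↦ (hleft t ht.2).symm).trans
    (hg.congr fun t ht ↦ (hright t ht.1).symm)⟩

end IsParallelSection

variable [ContMDiffVectorBundle 1 F V I] [FiniteDimensional ℝ F]

theorem covDerivAlong_eq_zero_of_hasDerivAt_fibreCoord {q₀ : N} {t : ℝ}
    (hq : γ t ∈ (trivializationAt F V q₀).baseSet)
    (hf : MDifferentiableAt 𝓘(ℝ, ℝ) (I.prod 𝓘(ℝ, F)) (sectionCurve F f) t)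
    (hderiv : HasDerivAt (fun s ↦ (trivializationAt F V q₀ (sectionCurve F f s)).2)
      (-connectionForm cov q₀ ⟨γ t, mfderiv 𝓘(ℝ, ℝ) I γ t (1 : ℝ)⟩
        (trivializationAt F V q₀ (sectionCurve F f t)).2) t) :
    covDerivAlong cov (sectionCurve F f) t = 0 := by
  rw [covDerivAlong_eq cov hq hf, hderiv.deriv, connectionForm_apply cov hq, map_neg]
  refine (congrArg (fun w ↦ -w + _) (constSection_trivializationAt hq _)).trans ?_
  exact neg_add_cancel _

theorem exists_nhdsWithin_isParallelSection [IsManifold I 1 N] (hcov : IsContinuousConnection cov)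
    (hab : a < b) (hγ : ContMDiffOn 𝓘(ℝ, ℝ) I 1 γ (Icc a b)) {t₀ : ℝ} (ht₀ : t₀ ∈ Icc a b) :
    ∃ U ∈ 𝓝[Icc a b] t₀, ∀ s s', s < s' → Icc s s' ⊆ Icc a b → Icc s s' ⊆ U →
      ∀ t₁ ∈ Icc s s', ∀ w : V (γ t₁),
        ∃ f : ∀ t, V (γ t), f t₁ = w ∧ IsParallelSection cov f s s' := by
  set e := trivializationAt F V (γ t₀)
  have : CompleteSpace F := FiniteDimensional.complete ℝ F
  have hW : γ ⁻¹' e.baseSet ∈ 𝓝[Icc a b] t₀ := (hγ.continuousOn t₀ ht₀).preimage_mem_nhdsWithin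
    (e.open_baseSet.mem_nhds (FiberBundle.mem_baseSet_trivializationAt' _))
  have hA : ContinuousOn (fun t ↦ -connectionForm cov (γ t₀)
      ⟨γ t, mfderivWithin 𝓘(ℝ, ℝ) I γ (Icc a b) t (1 : ℝ)⟩) (Icc a b ∩ γ ⁻¹' e.baseSet) :=
    ((continuousOn_connectionForm hcov (γ t₀)).comp ((continuousOn_velocity hab hγ).mono
      inter_subset_left) fun t ht ↦ ht.2).neg
  obtain ⟨U, hU, hode⟩ := exists_nhdsWithin_linear_ode ht₀ hW hA
  refine ⟨_, inter_mem hW hU, fun s s' hlt hsub hsU t₁ ht₁ w ↦ ?_⟩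
  obtain ⟨y, hy₁, hyC1, hy⟩ :=
    hode s s' hlt hsub (fun t ht ↦ (hsU ht).2) t₁ ht₁ (e ⟨γ t₁, w⟩).2
  have hbase : ∀ t ∈ Icc s s', γ t ∈ e.baseSet := fun t ht ↦ (hsU ht).1
  let f : ∀ t, V (γ t) := fun t ↦ constSection (γ t₀) (y t) (γ t)
  have hcoord : ∀ t ∈ Icc s s', (e (sectionCurve F f t)).2 = y t := fun t ht ↦
    trivializationAt_constSection (hbase t ht) (y t)
  have hf : ContMDiffOn 𝓘(ℝ, ℝ) (I.prod 𝓘(ℝ, F)) 1 (sectionCurve F f) (Icc s s') := by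
    rw [e.contMDiffOn_iff fun t ht ↦ e.mem_source.2 (hbase t ht)]
    exact ⟨hγ.mono hsub, hyC1.contMDiffOn.congr hcoord⟩
  refine ⟨f, ?_, .of_forall fun r r' _ hr ↦ ⟨hf.mono hr, fun t ht ↦ ?_⟩⟩
  · exact (congrArg (fun x ↦ constSection (γ t₀) x (γ t₁)) hy₁).trans
      (constSection_trivializationAt (hbase t₁ ht₁) w)
  have hts : t ∈ Icc s s' := hr (Ioo_subset_Icc_self ht)
  have hnhds : Icc s s' ∈ 𝓝 t := mem_of_superset (Icc_mem_nhds ht.1 ht.2) hr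
  refine covDerivAlong_eq_zero_of_hasDerivAt_fibreCoord (hbase t hts)
    ((hf.contMDiffAt hnhds).mdifferentiableAt one_ne_zero) ?_
  have hvelocity : mfderivWithin 𝓘(ℝ, ℝ) I γ (Icc a b) t = mfderiv 𝓘(ℝ, ℝ) I γ t :=
    mfderivWithin_of_mem_nhds (mem_of_superset hnhds hsub)
  have hyt := hy t (by rwa [← interior_Icc, mem_interior_iff_mem_nhds])
  rw [hvelocity] at hyt
  rw [hcoord t hts]
  exact hyt.congr_of_eventuallyEq (by filter_upwards [hnhds] with r hr using hcoord r hr)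

theorem exists_isParallelSection [IsManifold I 1 N] (hcov : IsContinuousConnection cov)
    (hab : a < b) (hγ : IsPiecewiseC1 I γ a b) :
    (∀ w : V (γ a), ∃ f : ∀ t, V (γ t), f a = w ∧ IsParallelSection cov f a b) ∧
      ∀ w : V (γ b), ∃ f : ∀ t, V (γ t), f b = w ∧ IsParallelSection cov f a b := by
  let R : ℝ → ℝ → Prop := fun s t ↦
    (∀ w : V (γ s), ∃ f : ∀ r, V (γ r), f s = w ∧ IsParallelSection cov f s t) ∧
      ∀ w : V (γ t), ∃ f : ∀ r, V (γ r), f t = w ∧ IsParallelSection cov f s t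
  have htrans : ∀ s t u, s < t → t < u → R s t → R t u → R s u := by
    rintro s t u hst htu ⟨hs, ht⟩ ⟨ht', hu⟩
    refine ⟨fun w ↦ ?_, fun w ↦ ?_⟩
    · obtain ⟨f, hfs, hf⟩ := hs w
      obtain ⟨g, hgt, hg⟩ := ht' (f t)
      obtain ⟨k, hkf, -, hk⟩ := hf.exists_glue hg hgt.symm
      exact ⟨k, (hkf s hst.le).trans hfs, hk⟩
    · obtain ⟨g, hgu, hg⟩ := hu w
      obtain ⟨f, hft, hf⟩ := ht (g t)
      obtain ⟨k, -, hkg, hk⟩ := hf.exists_glue hg hft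
      exact ⟨k, (hkg u htu.le).trans hgu, hk⟩
  refine PiecewiseOn.rel (R := R) (hγ.mono fun s s' hss _ hs ↦ ?_) hab htrans
  refine rel_of_forall_nhdsWithin hss htrans fun t ht ↦ ?_
  obtain ⟨U, hU, hexists⟩ := exists_nhdsWithin_isParallelSection (V := V) hcov hss hs ht
  exact ⟨U, hU, fun r r' hr hsub hrU ↦ ⟨hexists r r' hr hsub hrU r (left_mem_Icc.2 hr.le),
    hexists r r' hr hsub hrU r' (right_mem_Icc.2 hr.le)⟩⟩

end ParallelSections

section ParallelTransport

theorem exists_sectionCurve_eq {N F : Type*} {V : N → Type*} [∀ x, Nonempty (V x)] {γ : ℝ → N}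
    {α : ℝ → TotalSpace F V} {s : Set ℝ} (h : ∀ t ∈ s, (α t).proj = γ t) :
    ∃ f : ∀ t, V (γ t), ∀ t ∈ s, sectionCurve F f t = α t := by
  have hpoint : ∀ t, ∃ w : V (γ t), t ∈ s → TotalSpace.mk' F (γ t) w = α t := fun t ↦ by
    by_cases ht : t ∈ s
    · rw [← h t ht]
      exact ⟨(α t).2, fun _ ↦ rfl⟩
    · exact ⟨Classical.arbitrary _, fun ht' ↦ absurd ht' ht⟩
  choose f hf using hpoint
  exact ⟨f, hf⟩

theorem isContinuousRiemannianBundle_of_contMDiff {B : Type*} [NormedAddCommGroup B]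
    [NormedSpace ℝ B] {H : Type*} [TopologicalSpace H] (I : ModelWithCorners ℝ B H) (n : ℕ∞ω)
    {N : Type*} [TopologicalSpace N] [ChartedSpace H N]
    {F : Type*} [NormedAddCommGroup F] [NormedSpace ℝ F]
    {V : N → Type*} [TopologicalSpace (TotalSpace F V)] [∀ x, NormedAddCommGroup (V x)]
    [∀ x, InnerProductSpace ℝ (V x)] [FiberBundle F V] [VectorBundle ℝ F V]
    [hV : IsContMDiffRiemannianBundle I n F V] : IsContinuousRiemannianBundle F V := by
  obtain ⟨g, hg, hinner⟩ := hV.exists_contMDiff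
  exact ⟨g, hg.continuous, hinner⟩

theorem continuous_norm_totalSpace {X : Type*} [TopologicalSpace X]
    {F : Type*} [NormedAddCommGroup F] [NormedSpace ℝ F]
    {V : X → Type*} [TopologicalSpace (TotalSpace F V)] [∀ x, NormedAddCommGroup (V x)]
    [∀ x, InnerProductSpace ℝ (V x)] [FiberBundle F V] [VectorBundle ℝ F V]
    [IsContinuousRiemannianBundle F V] : Continuous fun p : TotalSpace F V ↦ ‖p.2‖ := by
  have h : Continuous fun p : TotalSpace F V ↦ TotalSpace.mk' F p.proj p.2 := continuous_id
  exact (h.inner_bundle h).sqrt.congr fun p ↦ (norm_eq_sqrt_real_inner p.2).symm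

variable {B : Type*} [NormedAddCommGroup B] [NormedSpace ℝ B]
  {H : Type*} [TopologicalSpace H] {I : ModelWithCorners ℝ B H}
  {N : Type*} [TopologicalSpace N] [ChartedSpace H N]
  {F : Type*} [NormedAddCommGroup F] [NormedSpace ℝ F]
  {V : N → Type*} [TopologicalSpace (TotalSpace F V)]
  [∀ x, NormedAddCommGroup (V x)] [∀ x, InnerProductSpace ℝ (V x)]
  [FiberBundle F V] [VectorBundle ℝ F V]
  {γ : ℝ → N} {f g : ∀ t, V (γ t)} {a b : ℝ}

theorem contMDiffOn_sectionCurve_add {n : ℕ∞ω} {s : Set ℝ}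
    (hf : ContMDiffOn 𝓘(ℝ, ℝ) (I.prod 𝓘(ℝ, F)) n (sectionCurve F f) s)
    (hg : ContMDiffOn 𝓘(ℝ, ℝ) (I.prod 𝓘(ℝ, F)) n (sectionCurve F g) s) :
    ContMDiffOn 𝓘(ℝ, ℝ) (I.prod 𝓘(ℝ, F)) n (sectionCurve F fun t ↦ f t + g t) s := by
  intro t ht
  obtain ⟨hγ, hf'⟩ := contMDiffWithinAt_totalSpace.1 (hf t ht)
  obtain ⟨-, hg'⟩ := contMDiffWithinAt_totalSpace.1 (hg t ht)
  have hq := FiberBundle.mem_baseSet_trivializationAt' (F := F) (E := V) (γ t)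
  have hadd : ∀ r, γ r ∈ (trivializationAt F V (γ t)).baseSet →
      (trivializationAt F V (γ t) ⟨γ r, f r + g r⟩).2
        = (trivializationAt F V (γ t) ⟨γ r, f r⟩).2
          + (trivializationAt F V (γ t) ⟨γ r, g r⟩).2 := fun r hr ↦ by
    simp only [trivializationAt_eq_continuousLinearMapAt hr, map_add]
  refine contMDiffWithinAt_totalSpace.2
    ⟨hγ, (hf'.add hg').congr_of_eventuallyEq ?_ (hadd t hq)⟩
  filter_upwards [hγ.continuousWithinAt.preimage_mem_nhdsWithin
    ((trivializationAt F V (γ t)).open_baseSet.mem_nhds hq)] with r hr using hadd r hr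

theorem contMDiffOn_sectionCurve_smul {n : ℕ∞ω} {s : Set ℝ} {c : ℝ → ℝ}
    (hc : ContDiffOn ℝ n c s)
    (hf : ContMDiffOn 𝓘(ℝ, ℝ) (I.prod 𝓘(ℝ, F)) n (sectionCurve F f) s) :
    ContMDiffOn 𝓘(ℝ, ℝ) (I.prod 𝓘(ℝ, F)) n (sectionCurve F fun t ↦ c t • f t) s := by
  intro t ht
  obtain ⟨hγ, hf'⟩ := contMDiffWithinAt_totalSpace.1 (hf t ht)
  have hq := FiberBundle.mem_baseSet_trivializationAt' (F := F) (E := V) (γ t)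
  have hsmul : ∀ r, γ r ∈ (trivializationAt F V (γ t)).baseSet →
      (trivializationAt F V (γ t) ⟨γ r, c r • f r⟩).2
        = c r • (trivializationAt F V (γ t) ⟨γ r, f r⟩).2 := fun r hr ↦ by
    simp only [trivializationAt_eq_continuousLinearMapAt hr, map_smul]
  refine contMDiffWithinAt_totalSpace.2
    ⟨hγ, ((hc.contMDiffOn t ht).smul hf').congr_of_eventuallyEq ?_ (hsmul t hq)⟩
  filter_upwards [hγ.continuousWithinAt.preimage_mem_nhdsWithin
    ((trivializationAt F V (γ t)).open_baseSet.mem_nhds hq)] with r hr using hsmul r hr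

variable {cov : CovariantDerivative I F V}

theorem lintegral_covDerivAlong_eq_zero {α : ℝ → TotalSpace F V}
    (h : ∀ᶠ t in cofinite, t ∈ Icc a b → covDerivAlong cov α t = 0) :
    ∫⁻ t in Icc a b, ‖covDerivAlong cov α t‖ₑ = 0 := by
  refine (lintegral_congr_ae (g := 0) ?_).trans lintegral_zero
  filter_upwards [ae_restrict_Icc_of_cofinite h] with t ht
  rw [ht, enorm_zero, Pi.zero_apply]

theorem IsParallelAlong.exists_section {α : ℝ → TotalSpace F V}
    (hα : IsParallelAlong cov γ α) :
    ∃ g : ∀ t, V (γ t), (∀ t ∈ Icc (0 : ℝ) 1, sectionCurve F g t = α t) ∧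
      ∀ᶠ t in cofinite, t ∈ Icc (0 : ℝ) 1 →
        MDifferentiableAt 𝓘(ℝ, ℝ) (I.prod 𝓘(ℝ, F)) (sectionCurve F g) t ∧
          covDerivAlong cov (sectionCurve F g) t = 0 := by
  obtain ⟨hproj, -, S, hS, hparallel⟩ := hα
  obtain ⟨g, hg⟩ := exists_sectionCurve_eq hproj
  refine ⟨g, hg, ?_⟩
  filter_upwards [hS.compl_mem_cofinite, (finite_singleton (0 : ℝ)).compl_mem_cofinite,
    (finite_singleton (1 : ℝ)).compl_mem_cofinite] with t htS ht0 ht1 ht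
  obtain ⟨hdiff, hzero⟩ := hparallel t ⟨ht, htS⟩
  have heq : sectionCurve F g =ᶠ[𝓝 t] α := by
    filter_upwards [Icc_mem_nhds (ht.1.lt_of_ne' ht0) (ht.2.lt_of_ne ht1)] with r hr using hg r hr
  refine ⟨hdiff.congr_of_eventuallyEq heq, ?_⟩
  rw [← norm_eq_zero, norm_covDerivAlong_congr heq, hzero, norm_zero]

variable [ContMDiffVectorBundle 1 F V I] [FiniteDimensional ℝ F]
  [IsContMDiffRiemannianBundle I 1 F V]

theorem hasDerivAt_sqrt_inner_self_add (hmetric : cov.IsMetricCompatible) {ε : ℝ} (hε : 0 < ε)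
    {α : ℝ → TotalSpace F V} {t : ℝ}
    (hα : MDifferentiableAt 𝓘(ℝ, ℝ) (I.prod 𝓘(ℝ, F)) α t) :
    HasDerivAt (fun s ↦ √(inner ℝ (α s).2 (α s).2 + ε))
      (inner ℝ (covDerivAlong cov α t) (α t).2 / √(inner ℝ (α t).2 (α t).2 + ε)) t := by
  have hpos : 0 < inner ℝ (α t).2 (α t).2 + ε :=
    add_pos_of_nonneg_of_pos real_inner_self_nonneg hε
  convert ((hasDerivAt_inner_self hmetric hα).add_const ε).sqrt hpos.ne' using 1
  rw [mul_div_mul_left _ _ two_ne_zero]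

theorem enorm_sqrt_sub_sqrt_le (hmetric : cov.IsMetricCompatible) (hab : a ≤ b) {ε : ℝ}
    (hε : 0 < ε) {α : ℝ → TotalSpace F V} (hα : ContinuousOn (fun t ↦ ‖(α t).2‖) (Icc a b))
    (hdiff : ∀ᶠ t in cofinite, t ∈ Icc a b →
      MDifferentiableAt 𝓘(ℝ, ℝ) (I.prod 𝓘(ℝ, F)) α t) :
    ‖√(inner ℝ (α b).2 (α b).2 + ε) - √(inner ℝ (α a).2 (α a).2 + ε)‖ₑ
      ≤ ∫⁻ t in Icc a b, ‖covDerivAlong cov α t‖ₑ := by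
  refine enorm_sub_le_lintegral (u := fun t ↦ √(inner ℝ (α t).2 (α t).2 + ε)) hab ?_ ?_
  · simp only [real_inner_self_eq_norm_sq]
    exact ((hα.pow 2).add continuousOn_const).sqrt
  filter_upwards [hdiff] with t hdiff ht
  have hderiv := hasDerivAt_sqrt_inner_self_add hmetric hε (hdiff ht)
  refine ⟨hderiv.differentiableAt, ?_⟩
  rw [hderiv.deriv, enorm_le_iff_norm_le, norm_div, Real.norm_of_nonneg (Real.sqrt_nonneg _)]
  refine div_le_of_le_mul₀ (Real.sqrt_nonneg _) (norm_nonneg _)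
    ((norm_inner_le_norm _ _).trans ?_)
  gcongr
  refine Real.le_sqrt_of_sq_le ?_
  rw [real_inner_self_eq_norm_sq]
  exact le_add_of_nonneg_right hε.le

theorem enorm_norm_sub_norm_le (hmetric : cov.IsMetricCompatible) (hab : a ≤ b)
    {α : ℝ → TotalSpace F V} (hα : ContinuousOn (fun t ↦ ‖(α t).2‖) (Icc a b))
    (hdiff : ∀ᶠ t in cofinite, t ∈ Icc a b →
      MDifferentiableAt 𝓘(ℝ, ℝ) (I.prod 𝓘(ℝ, F)) α t) :
    ‖‖(α b).2‖ - ‖(α a).2‖‖ₑ ≤ ∫⁻ t in Icc a b, ‖covDerivAlong cov α t‖ₑ := by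
  have hlim : Tendsto
      (fun ε : ℝ ↦ ‖√(inner ℝ (α b).2 (α b).2 + ε) - √(inner ℝ (α a).2 (α a).2 + ε)‖ₑ)
      (𝓝[>] 0) (𝓝 ‖‖(α b).2‖ - ‖(α a).2‖‖ₑ) := by
    rw [norm_eq_sqrt_real_inner (α b).2, norm_eq_sqrt_real_inner (α a).2]
    refine Tendsto.mono_left ?_ nhdsWithin_le_nhds
    have hcont : Continuous
        (fun ε : ℝ ↦ ‖√(inner ℝ (α b).2 (α b).2 + ε) - √(inner ℝ (α a).2 (α a).2 + ε)‖ₑ) := by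
      fun_prop
    simpa only [add_zero] using hcont.tendsto 0
  exact le_of_tendsto hlim (eventually_mem_nhdsWithin.mono fun ε hε ↦
    enorm_sqrt_sub_sqrt_le hmetric hab hε hα hdiff)

theorem enorm_sub_le_lintegral_covDerivAlong (hmetric : cov.IsMetricCompatible) (hab : a ≤ b)
    (hf : ContinuousOn (sectionCurve F f) (Icc a b))
    (hg : ContinuousOn (sectionCurve F g) (Icc a b))
    (hfdiff : ∀ᶠ t in cofinite, t ∈ Icc a b →
      MDifferentiableAt 𝓘(ℝ, ℝ) (I.prod 𝓘(ℝ, F)) (sectionCurve F f) t)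
    (hgparallel : ∀ᶠ t in cofinite, t ∈ Icc a b →
      MDifferentiableAt 𝓘(ℝ, ℝ) (I.prod 𝓘(ℝ, F)) (sectionCurve F g) t ∧
        covDerivAlong cov (sectionCurve F g) t = 0) (hb : f b = g b) :
    ‖f a - g a‖ₑ ≤ ∫⁻ t in Icc a b, ‖covDerivAlong cov (sectionCurve F f) t‖ₑ := by
  let k : ∀ t, V (γ t) := fun t ↦ f t + (-1 : ℝ) • g t
  have hk : ∀ t, k t = f t - g t := fun t ↦ by rw [sub_eq_add_neg, ← neg_one_smul ℝ (g t)]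
  have hkcont : ContinuousOn (sectionCurve F k) (Icc a b) :=
    (contMDiffOn_sectionCurve_add (I := I) (contMDiffOn_zero_iff.2 hf)
      (contMDiffOn_sectionCurve_smul contDiffOn_const (contMDiffOn_zero_iff.2 hg))).continuousOn
  have hkdiff : ∀ᶠ t in cofinite, t ∈ Icc a b →
      MDifferentiableAt 𝓘(ℝ, ℝ) (I.prod 𝓘(ℝ, F)) (sectionCurve F k) t ∧
        covDerivAlong cov (sectionCurve F k) t = covDerivAlong cov (sectionCurve F f) t := by
    filter_upwards [hfdiff, hgparallel] with t hft hgt ht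
    have hsmul := mdifferentiableAt_sectionCurve_smul
      (differentiableAt_const (-1 : ℝ)) (hgt ht).1
    refine ⟨mdifferentiableAt_sectionCurve_add (hft ht) hsmul, ?_⟩
    rw [covDerivAlong_add cov (hft ht) hsmul,
      covDerivAlong_smul cov (differentiableAt_const _) (hgt ht).1, (hgt ht).2, deriv_const,
      smul_zero, zero_smul, add_zero, add_zero]
  have := isContinuousRiemannianBundle_of_contMDiff I 1 (F := F) (V := V)
  have hnorm := enorm_norm_sub_norm_le hmetric hab
    (continuous_norm_totalSpace.comp_continuousOn hkcont)
    (hkdiff.mono fun t ht hmem ↦ (ht hmem).1)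
  rw [show (sectionCurve F k b).2 = 0 from (hk b).trans (sub_eq_zero.2 hb),
    show (sectionCurve F k a).2 = f a - g a from hk a, norm_zero, zero_sub, enorm_neg,
    enorm_norm] at hnorm
  refine hnorm.trans_eq (lintegral_congr_ae ?_)
  filter_upwards [ae_restrict_Icc_of_cofinite hkdiff] with t ht
  exact congrArg (fun w : V (γ t) ↦ ‖w‖ₑ) ht.2

theorem IsParallelSection.norm_eq (hmetric : cov.IsMetricCompatible) (hab : a < b)
    (hf : IsParallelSection cov f a b) {t : ℝ} (ht : t ∈ Icc a b) : ‖f t‖ = ‖f a‖ := by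
  have hsub : Icc a t ⊆ Icc a b := Icc_subset_Icc_right ht.2
  have := isContinuousRiemannianBundle_of_contMDiff I 1 (F := F) (V := V)
  have hle := enorm_norm_sub_norm_le (α := sectionCurve F f) hmetric ht.1
    (continuous_norm_totalSpace.comp_continuousOn
      ((hf.isPiecewiseC1.continuousOn hab).mono hsub))
    (hf.isPiecewiseC1.mdifferentiableAt.mono fun s hs hmem ↦ hs (hsub hmem))
  rwa [lintegral_covDerivAlong_eq_zero
      (hf.covDerivAlong_eq_zero.mono fun s hs hmem ↦ hs (hsub hmem)),
    nonpos_iff_eq_zero, enorm_eq_zero, sub_eq_zero] at hle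

theorem parallelTransport_eq (hmetric : cov.IsMetricCompatible)
    (hf : IsParallelSection cov f 0 1) : parallelTransport cov γ (f 1) = f 0 := by
  have hfcont := hf.isPiecewiseC1.continuousOn one_pos
  have hfdiff := hf.isPiecewiseC1.mdifferentiableAt
  have hexists : ∃ w : V (γ 0), ∃ α : ℝ → TotalSpace F V, IsParallelAlong cov γ α ∧
      α 0 = ⟨γ 0, w⟩ ∧ α 1 = ⟨γ 1, f 1⟩ := by
    refine ⟨f 0, sectionCurve F f, ⟨fun _ _ ↦ rfl, hfcont, _,
      eventually_cofinite.1 (hfdiff.and hf.covDerivAlong_eq_zero), fun t ht ↦ ?_⟩, rfl, rfl⟩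
    obtain ⟨hd, hz⟩ := not_not.1 ht.2
    exact ⟨hd ht.1, hz ht.1⟩
  obtain ⟨α, hα, hα₀, hα₁⟩ := Classical.epsilon_spec hexists
  obtain ⟨g, hg, hgparallel⟩ := hα.exists_section
  have hg₀ : g 0 = parallelTransport cov γ (f 1) :=
    TotalSpace.mk_injective _ ((hg 0 (by simp)).trans hα₀)
  have hg₁ : g 1 = f 1 := TotalSpace.mk_injective _ ((hg 1 (by simp)).trans hα₁)
  have hle := enorm_sub_le_lintegral_covDerivAlong hmetric zero_le_one hfcont
    (hα.2.1.congr hg) hfdiff hgparallel hg₁.symm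
  rw [lintegral_covDerivAlong_eq_zero hf.covDerivAlong_eq_zero, nonpos_iff_eq_zero,
    enorm_eq_zero, sub_eq_zero] at hle
  rw [← hg₀, hle]

end ParallelTransport

section RegularCurves

variable {B : Type*} [NormedAddCommGroup B] [NormedSpace ℝ B]
  {H : Type*} [TopologicalSpace H] {I : ModelWithCorners ℝ B H}
  {N : Type*} [TopologicalSpace N] [ChartedSpace H N] {γ : ℝ → N} {a b s s' : ℝ}

variable (I) in
/-- `γ` is smooth with nowhere vanishing velocity on `[a, b]` (one-sided at the end points). -/
def IsRegularOn (γ : ℝ → N) (a b : ℝ) : Prop :=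
  ContMDiffOn 𝓘(ℝ, ℝ) I ∞ γ (Icc a b) ∧
    ∀ t ∈ Icc a b, mfderivWithin 𝓘(ℝ, ℝ) I γ (Icc a b) t (1 : ℝ) ≠ 0

theorem IsRegularOn.mono (h : IsRegularOn I γ a b) (hs : s < s') (hsub : Icc s s' ⊆ Icc a b) :
    IsRegularOn I γ s s' := by
  refine ⟨h.1.mono hsub, fun t ht ↦ ?_⟩
  rw [mfderivWithin_subset hsub (uniqueMDiffWithinAt_iff_uniqueDiffWithinAt.2
    (uniqueDiffOn_Icc hs t ht)) ((h.1 t (hsub ht)).mdifferentiableWithinAt (by simp))]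
  exact h.2 t (hsub ht)

theorem isPiecewiseC1_of_isRegularOn (h : PiecewiseOn (IsRegularOn I γ) a b) :
    IsPiecewiseC1 I γ a b :=
  h.mono fun _ _ _ _ hs ↦ hs.1.of_le (by simp)

theorem piecewiseOn_isRegularOn_of_subdivision {m : ℕ} {τ : ℕ → ℝ}
    (h : ∀ i < m, IsRegularOn I γ (τ i) (τ (i + 1))) :
    PiecewiseOn (IsRegularOn I γ) (τ 0) (τ m) := by
  induction m with
  | zero =>
    refine .of_forall fun s s' hs hsub ↦ absurd hs (not_lt.2 ?_)
    obtain ⟨hle, hle'⟩ := (Icc_subset_Icc_iff hs.le).1 hsub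
    exact hle'.trans hle
  | succ m ih =>
    refine (ih fun i hi ↦ h i (by omega)).trans (.of_forall fun s s' hs hsub ↦ ?_)
    exact (h m (by omega)).mono hs hsub

theorem exists_subdivision_append {P : ℝ → ℝ → Prop} {c : ℝ}
    (h : ∃ (m : ℕ) (τ : ℕ → ℝ), τ 0 = a ∧ τ m = b ∧ ∀ i < m, P (τ i) (τ (i + 1)))
    (h' : ∃ (m : ℕ) (τ : ℕ → ℝ), τ 0 = b ∧ τ m = c ∧ ∀ i < m, P (τ i) (τ (i + 1))) :
    ∃ (m : ℕ) (τ : ℕ → ℝ), τ 0 = a ∧ τ m = c ∧ ∀ i < m, P (τ i) (τ (i + 1)) := by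
  obtain ⟨m, τ, h0, h1, h⟩ := h
  obtain ⟨m', τ', h0', h1', h'⟩ := h'
  let σ : ℕ → ℝ := fun i ↦ if i ≤ m then τ i else τ' (i - m)
  have hleft : ∀ i ≤ m, σ i = τ i := fun i hi ↦ if_pos hi
  have hright : ∀ i, σ (m + i) = τ' i := fun i ↦ by
    rcases i.eq_zero_or_pos with rfl | hi
    · simp [σ, h1, h0']
    · simp [σ, hi.ne']
  refine ⟨m + m', σ, (hleft 0 m.zero_le).trans h0, (hright m').trans h1', fun i hi ↦ ?_⟩
  rcases lt_or_ge i m with him | him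
  · rw [hleft i him.le, hleft (i + 1) him]
    exact h i him
  · obtain ⟨j, rfl⟩ := Nat.exists_eq_add_of_le him
    rw [hright, add_assoc, hright]
    exact h' j (by omega)

theorem isPiecewiseRegular_iff :
    IsPiecewiseRegular I γ ↔ PiecewiseOn (IsRegularOn I γ) 0 1 := by
  constructor
  · rintro ⟨m, τ, h0, h1, h⟩
    rw [← h0, ← h1]
    exact piecewiseOn_isRegularOn_of_subdivision fun i hi ↦ (h i hi).2
  · intro h
    have hstrict : PiecewiseOn (fun s s' ↦ s < s' ∧ IsRegularOn I γ s s') 0 1 :=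
      h.mono fun s s' hs _ hreg ↦ ⟨hs, hreg⟩
    refine PiecewiseOn.rel (R := fun a b ↦ ∃ (m : ℕ) (τ : ℕ → ℝ), τ 0 = a ∧ τ m = b ∧
      ∀ i < m, τ i < τ (i + 1) ∧ IsRegularOn I γ (τ i) (τ (i + 1)))
      (hstrict.mono fun s s' _ _ hreg ↦ ?_) one_pos fun _ _ _ _ _ ↦
      exists_subdivision_append (P := fun s s' ↦ s < s' ∧ IsRegularOn I γ s s')
    refine ⟨1, fun i ↦ if i = 0 then s else s', by simp, by simp, fun i hi ↦ ?_⟩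
    obtain rfl := Nat.lt_one_iff.1 hi
    exact hreg

end RegularCurves

section ArcLength

variable {E : Type*} [NormedAddCommGroup E] [NormedSpace ℝ E]
  {H : Type*} [TopologicalSpace H] {I : ModelWithCorners ℝ E H}
  {M : Type*} [TopologicalSpace M] [ChartedSpace H M]
  [RiemannianBundle (fun x : M ↦ TangentSpace I x)] {γ : ℝ → M} {a b : ℝ}

theorem pathELength_eq_ofReal_integral {w : ℝ → ℝ} (hw : Continuous w)
    (hwγ : ∀ t ∈ Ioo a b, w t = ‖mfderiv 𝓘(ℝ, ℝ) I γ t (1 : ℝ)‖) {t : ℝ} (ht : t ∈ Icc a b) :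
    pathELength I γ a t = ENNReal.ofReal (∫ r in a..t, w r) := by
  have hwγ' : ∀ r ∈ Ioo a t, w r = ‖mfderiv 𝓘(ℝ, ℝ) I γ r (1 : ℝ)‖ := fun r hr ↦
    hwγ r ⟨hr.1, hr.2.trans_le ht.2⟩
  rw [pathELength_eq_lintegral_mfderiv_Ioo, intervalIntegral.integral_of_le ht.1,
    integral_Ioc_eq_integral_Ioo, ofReal_integral_eq_lintegral_ofReal
      ((hw.integrableOn_Icc).mono_set Ioo_subset_Icc_self)
      (ae_restrict_of_forall_mem measurableSet_Ioo fun r hr ↦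
        (hwγ' r hr).symm ▸ norm_nonneg _)]
  refine setLIntegral_congr_fun measurableSet_Ioo fun r hr ↦ ?_
  rw [hwγ' r hr]
  exact (ofReal_norm _).symm

theorem IsPiecewiseC1.riemannianEDist_le_pathELength (hγ : IsPiecewiseC1 I γ a b) (hab : a < b) :
    riemannianEDist I (γ a) (γ b) ≤ pathELength I γ a b := by
  refine PiecewiseOn.rel (R := fun s s' ↦ riemannianEDist I (γ s) (γ s') ≤ pathELength I γ s s')
    (hγ.mono fun s s' hs _ hC1 ↦ Manifold.riemannianEDist_le_pathELength hC1 rfl rfl hs.le)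
    hab fun s t u hst htu h h' ↦ ?_
  rw [← pathELength_add hst.le htu.le]
  exact riemannianEDist_triangle.trans (add_le_add h h')

variable [IsManifold I 1 M] [IsContinuousRiemannianBundle E (fun x : M ↦ TangentSpace I x)]

theorem exists_continuous_speed (hab : a < b) (hγ : ContMDiffOn 𝓘(ℝ, ℝ) I 1 γ (Icc a b)) :
    ∃ w : ℝ → ℝ, Continuous w ∧ ∀ t ∈ Ioo a b, w t = ‖mfderiv 𝓘(ℝ, ℝ) I γ t (1 : ℝ)‖ := by
  have hcont : ContinuousOn (fun t ↦ ‖mfderivWithin 𝓘(ℝ, ℝ) I γ (Icc a b) t (1 : ℝ)‖) (Icc a b) :=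
    (continuous_norm_totalSpace (F := E) (V := fun x : M ↦ TangentSpace I x)).comp_continuousOn
      (continuousOn_velocity hab hγ)
  refine ⟨_, (continuousOn_iff_continuous_domRestrict.1 hcont).Icc_extend' (h := hab.le),
    fun t ht ↦ ?_⟩
  rw [IccExtend_of_mem _ _ (Ioo_subset_Icc_self ht), domRestrict_apply,
    mfderivWithin_of_mem_nhds (Icc_mem_nhds ht.1 ht.2)]

theorem IsPiecewiseC1.pathELength_ne_top (hγ : IsPiecewiseC1 I γ a b) (hab : a < b) :
    pathELength I γ a b ≠ ⊤ := by
  refine PiecewiseOn.rel (R := fun s s' ↦ pathELength I γ s s' ≠ ⊤)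
    (hγ.mono fun s s' hs _ hC1 ↦ ?_) hab fun s t u hst htu h h' ↦ ?_
  · obtain ⟨w, hw, hwγ⟩ := exists_continuous_speed hs hC1
    rw [pathELength_eq_ofReal_integral hw hwγ (right_mem_Icc.2 hs.le)]
    exact ENNReal.ofReal_ne_top
  · rw [← pathELength_add hst.le htu.le]
    exact ENNReal.add_ne_top.2 ⟨h, h'⟩

variable (I) in
/-- The arc length function of a curve of finite length. -/
def arcLength (γ : ℝ → M) (a t : ℝ) : ℝ :=
  (pathELength I γ a t).toReal

theorem IsPiecewiseC1.contDiffOn_arcLength (hγ : IsPiecewiseC1 I γ a b) (hab : a < b) :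
    PiecewiseOn (fun s s' ↦ ContDiffOn ℝ 1 (arcLength I γ a) (Icc s s') ∧
      ∀ t ∈ Ioo s s', deriv (arcLength I γ a) t = ‖mfderiv 𝓘(ℝ, ℝ) I γ t (1 : ℝ)‖) a b := by
  have hfinite := hγ.pathELength_ne_top hab
  refine hγ.mono fun s s' hs hsub hC1 ↦ ?_
  obtain ⟨has, hsb⟩ := (Icc_subset_Icc_iff hs.le).1 hsub
  obtain ⟨w, hw, hwγ⟩ := exists_continuous_speed hs hC1
  have hadd : EqOn (arcLength I γ a) (fun t ↦ arcLength I γ a s + ∫ r in s..t, w r) (Icc s s') := by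
    intro t ht
    have hs_top : pathELength I γ a s ≠ ⊤ :=
      ne_top_of_le_ne_top hfinite (pathELength_mono le_rfl (hs.le.trans hsb))
    have hnonneg : 0 ≤ ∫ r in s..t, w r := by
      rw [intervalIntegral.integral_of_le ht.1, integral_Ioc_eq_integral_Ioo]
      exact setIntegral_nonneg measurableSet_Ioo fun r hr ↦
        (hwγ r ⟨hr.1, hr.2.trans_le ht.2⟩).symm ▸ norm_nonneg _
    rw [arcLength, ← pathELength_add has ht.1, pathELength_eq_ofReal_integral hw hwγ ht,
      ENNReal.toReal_add hs_top ENNReal.ofReal_ne_top, ENNReal.toReal_ofReal hnonneg]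
    rfl
  have hderiv (t : ℝ) : HasDerivAt (fun t ↦ arcLength I γ a s + ∫ r in s..t, w r) (w t) t :=
    (hw.integral_hasStrictDerivAt s t).hasDerivAt.const_add _
  refine ⟨ContDiffOn.congr (ContDiff.contDiffOn ?_) hadd, fun t ht ↦ ?_⟩
  · rw [contDiff_one_iff_deriv, funext fun t ↦ (hderiv t).deriv]
    exact ⟨fun t ↦ (hderiv t).differentiableAt, hw⟩
  · rw [(hadd.eventuallyEq_of_mem (Icc_mem_nhds ht.1 ht.2)).deriv_eq, (hderiv t).deriv, hwγ t ht]

theorem pathELength_pos (hγ : PiecewiseOn (IsRegularOn I γ) a b) (hab : a < b) :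
    0 < pathELength I γ a b := by
  refine PiecewiseOn.rel (R := fun s s' ↦ 0 < pathELength I γ s s')
    (hγ.mono fun s s' hs _ hreg ↦ ?_) hab fun s t u hst htu h _ ↦ ?_
  · obtain ⟨w, hw, hwγ⟩ := exists_continuous_speed hs (hreg.1.of_le (by simp))
    rw [pathELength_eq_ofReal_integral hw hwγ (right_mem_Icc.2 hs.le), ENNReal.ofReal_pos]
    refine intervalIntegral.intervalIntegral_pos_of_pos_on (hw.intervalIntegrable s s')
      (fun t ht ↦ ?_) hs
    rw [hwγ t ht, norm_pos_iff, ← mfderivWithin_of_mem_nhds (Icc_mem_nhds ht.1 ht.2)]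
    exact hreg.2 t (Ioo_subset_Icc_self ht)
  · rw [← pathELength_add hst.le htu.le]
    exact h.trans_le le_self_add

end ArcLength

section SasakiMetric

variable {B : Type*} [NormedAddCommGroup B] [NormedSpace ℝ B]
  {H : Type*} [TopologicalSpace H] {I : ModelWithCorners ℝ B H}
  {N : Type*} [TopologicalSpace N] [ChartedSpace H N]
  {F : Type*} [NormedAddCommGroup F] [NormedSpace ℝ F]
  {V : N → Type*} [TopologicalSpace (TotalSpace F V)]
  [∀ x, NormedAddCommGroup (V x)] [∀ x, InnerProductSpace ℝ (V x)]
  [FiberBundle F V] [VectorBundle ℝ F V]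
  {cov : CovariantDerivative I F V} {γ : ℝ → N} {a b t : ℝ}

theorem contMDiffOn_add_smul_parallel {X Y : ∀ t, V (γ t)} (hX : IsParallelSection cov X a b)
    (hY : IsParallelSection cov Y a b) {c : ℝ → ℝ}
    (hc : PiecewiseOn (fun s s' ↦ ContDiffOn ℝ 1 c (Icc s s')) a b) :
    IsPiecewiseC1 (I.prod 𝓘(ℝ, F)) (sectionCurve F fun t ↦ X t + c t • Y t) a b :=
  ((hX.isPiecewiseC1.and hY.isPiecewiseC1).and hc).mono fun _ _ _ _ h ↦
    contMDiffOn_sectionCurve_add h.1.1 (contMDiffOn_sectionCurve_smul h.2 h.1.2)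

variable [FiniteDimensional ℝ F] [ContMDiffVectorBundle 1 F V I]

theorem covDerivAlong_add_smul_parallel {X Y : ∀ t, V (γ t)} {c : ℝ → ℝ}
    (hX : MDifferentiableAt 𝓘(ℝ, ℝ) (I.prod 𝓘(ℝ, F)) (sectionCurve F X) t)
    (hX₀ : covDerivAlong cov (sectionCurve F X) t = 0)
    (hY : MDifferentiableAt 𝓘(ℝ, ℝ) (I.prod 𝓘(ℝ, F)) (sectionCurve F Y) t)
    (hY₀ : covDerivAlong cov (sectionCurve F Y) t = 0) (hc : DifferentiableAt ℝ c t) :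
    covDerivAlong cov (sectionCurve F fun t ↦ X t + c t • Y t) t = deriv c t • Y t := by
  have hadd := covDerivAlong_add cov hX (mdifferentiableAt_sectionCurve_smul hc hY)
  have hsmul := covDerivAlong_smul cov hc hY
  rw [hX₀, hsmul, hY₀] at hadd
  simpa only [smul_zero, zero_add] using hadd

variable [FiniteDimensional ℝ B] [RiemannianBundle (fun x : N ↦ TangentSpace I x)]

variable (cov) in
/-- The Riemannian structure of the total space given by the Sasaki metric. It is passed explicitly
because it depends on the connection. -/
abbrev sasakiBundle :
    RiemannianBundle (fun p : TotalSpace F V ↦ TangentSpace (I.prod 𝓘(ℝ, F)) p) :=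
  ⟨sasakiMetric cov⟩

theorem sasaki_enorm_sq (p : TotalSpace F V) (ξ : TangentSpace (I.prod 𝓘(ℝ, F)) p) :
    letI := sasakiBundle cov
    ‖ξ‖ₑ ^ 2 = ‖dproj I F V p ξ‖ₑ ^ 2 + ‖connector cov p ξ‖ₑ ^ 2 := by
  let _ := sasakiBundle cov
  have h : inner ℝ ξ ξ = inner ℝ (dproj I F V p ξ) (dproj I F V p ξ)
    + inner ℝ (connector cov p ξ) (connector cov p ξ) := rfl
  simp only [real_inner_self_eq_norm_sq] at h
  rw [← ofReal_norm, ← ofReal_norm, ← ofReal_norm,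
    ← ENNReal.ofReal_pow (norm_nonneg _), ← ENNReal.ofReal_pow (norm_nonneg _),
    ← ENNReal.ofReal_pow (norm_nonneg _), ← ENNReal.ofReal_add (by positivity) (by positivity)]
  exact congrArg ENNReal.ofReal h

theorem sasaki_enorm_mfderiv_sq {α : ℝ → TotalSpace F V}
    (hα : MDifferentiableAt 𝓘(ℝ, ℝ) (I.prod 𝓘(ℝ, F)) α t) :
    letI := sasakiBundle cov
    ‖mfderiv 𝓘(ℝ, ℝ) (I.prod 𝓘(ℝ, F)) α t (1 : ℝ)‖ₑ ^ 2
      = ‖mfderiv 𝓘(ℝ, ℝ) I (fun s ↦ (α s).proj) t (1 : ℝ)‖ₑ ^ 2 + ‖covDerivAlong cov α t‖ₑ ^ 2 := by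
  have h := sasaki_enorm_sq (cov := cov) (α t) (mfderiv 𝓘(ℝ, ℝ) (I.prod 𝓘(ℝ, F)) α t (1 : ℝ))
  rwa [dproj_mfderiv_curve hα] at h

theorem continuous_sasaki_norm [IsManifold I 1 N]
    [IsContinuousRiemannianBundle B (fun x : N ↦ TangentSpace I x)]
    [IsContinuousRiemannianBundle F V] (hcov : IsContinuousConnection cov) :
    letI := sasakiBundle cov
    Continuous fun ξ : TangentBundle (I.prod 𝓘(ℝ, F)) (TotalSpace F V) ↦ ‖ξ.2‖ :=
  (continuous_inner_dproj_add_inner_connector hcov).sqrt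

end SasakiMetric

section UpperBound

variable {B : Type*} [NormedAddCommGroup B] [NormedSpace ℝ B] [FiniteDimensional ℝ B]
  {H : Type*} [TopologicalSpace H] {I : ModelWithCorners ℝ B H}
  {N : Type*} [TopologicalSpace N] [ChartedSpace H N] [IsManifold I 1 N]
  [RiemannianBundle (fun x : N ↦ TangentSpace I x)]
  [IsContinuousRiemannianBundle B (fun x : N ↦ TangentSpace I x)]
  {F : Type*} [NormedAddCommGroup F] [NormedSpace ℝ F] [FiniteDimensional ℝ F]
  {V : N → Type*} [TopologicalSpace (TotalSpace F V)]
  [∀ x, NormedAddCommGroup (V x)] [∀ x, InnerProductSpace ℝ (V x)]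
  [FiberBundle F V] [VectorBundle ℝ F V] [ContMDiffVectorBundle 1 F V I]
  [IsContMDiffRiemannianBundle I 1 F V]
  {cov : CovariantDerivative I F V} {γ : ℝ → N}

theorem sasaki_enorm_mfderiv_add_smul_parallel_sq (hmetric : cov.IsMetricCompatible)
    (hγ : IsPiecewiseC1 I γ 0 1) (hγ₀ : pathELength I γ 0 1 ≠ 0)
    {X Y : ∀ t, V (γ t)} (hX : IsParallelSection cov X 0 1) (hY : IsParallelSection cov Y 0 1) :
    letI := sasakiBundle cov
    ∀ᶠ t in cofinite, t ∈ Icc (0 : ℝ) 1 →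
      ‖mfderiv 𝓘(ℝ, ℝ) (I.prod 𝓘(ℝ, F))
        (sectionCurve F fun t ↦ X t + (1 - arcLength I γ 0 t / arcLength I γ 0 1) • Y t) t
          (1 : ℝ)‖ₑ ^ 2
        = ‖mfderiv 𝓘(ℝ, ℝ) I γ t (1 : ℝ)‖ₑ ^ 2
          + (‖mfderiv 𝓘(ℝ, ℝ) I γ t (1 : ℝ)‖ₑ / pathELength I γ 0 1 * ‖Y 0‖ₑ) ^ 2 := by
  let _ := sasakiBundle cov
  have hl : 0 < arcLength I γ 0 1 := ENNReal.toReal_pos hγ₀ (hγ.pathELength_ne_top one_pos)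
  filter_upwards [hX.isPiecewiseC1.mdifferentiableAt, hX.covDerivAlong_eq_zero,
    hY.isPiecewiseC1.mdifferentiableAt, hY.covDerivAlong_eq_zero,
    (hγ.contDiffOn_arcLength one_pos).eventually_cofinite] with t hXt hX₀ hYt hY₀ harc htI
  obtain ⟨s, s', hts, -, hlC1, hlderiv⟩ := harc htI
  have hlt : DifferentiableAt ℝ (arcLength I γ 0) t :=
    (hlC1.contDiffAt (Icc_mem_nhds hts.1 hts.2)).differentiableAt one_ne_zero
  have hslope : HasDerivAt (fun t ↦ 1 - arcLength I γ 0 t / arcLength I γ 0 1)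
      (-(‖mfderiv 𝓘(ℝ, ℝ) I γ t (1 : ℝ)‖ / arcLength I γ 0 1)) t := by
    rw [← hlderiv t hts]
    exact (hlt.hasDerivAt.div_const _).const_sub 1
  have hcov := covDerivAlong_add_smul_parallel (hXt htI) (hX₀ htI) (hYt htI) (hY₀ htI)
    hslope.differentiableAt
  rw [sasaki_enorm_mfderiv_sq (mdifferentiableAt_sectionCurve_add (hXt htI)
    (mdifferentiableAt_sectionCurve_smul hslope.differentiableAt (hYt htI)))]
  congr 2
  refine (congrArg (fun w : V (γ t) ↦ ‖w‖ₑ) hcov).trans ?_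
  rw [hslope.deriv, enorm_smul, enorm_neg, ← ofReal_norm (Y t), hY.norm_eq hmetric one_pos htI,
    ofReal_norm, Real.enorm_of_nonneg (by positivity), ENNReal.ofReal_div_of_pos hl,
    arcLength, ENNReal.ofReal_toReal (hγ.pathELength_ne_top one_pos)]
  congr 2
  exact ofReal_norm _

theorem sasakiEDist_sq_le (hcov : IsContinuousConnection cov) (hmetric : cov.IsMetricCompatible)
    (hγ : IsPiecewiseC1 I γ 0 1) (hγ₀ : pathELength I γ 0 1 ≠ 0) (e₁ : V (γ 0)) (e₂ : V (γ 1)) :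
    sasakiEDist cov ⟨γ 0, e₁⟩ ⟨γ 1, e₂⟩ ^ 2 ≤
      ‖e₁ - parallelTransport cov γ e₂‖ₑ ^ 2 + pathELength I γ 0 1 ^ 2 := by
  let _ := sasakiBundle cov
  obtain ⟨X, rfl, hX⟩ := (exists_isParallelSection hcov one_pos hγ).2 e₂
  obtain ⟨Y, hY₀, hY⟩ := (exists_isParallelSection hcov one_pos hγ).1 (e₁ - X 0)
  rw [parallelTransport_eq hmetric hX, ← hY₀]
  have hL := hγ.pathELength_ne_top one_pos
  have hL₁ : arcLength I γ 0 1 ≠ 0 := (ENNReal.toReal_pos hγ₀ hL).ne'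
  have hL₀ : arcLength I γ 0 0 = 0 := by simp [arcLength]
  let f : ∀ t, V (γ t) := fun t ↦ X t + (1 - arcLength I γ 0 t / arcLength I γ 0 1) • Y t
  have hf₀ : f 0 = e₁ := by
    simp only [f, hL₀, zero_div, sub_zero, one_smul, hY₀, add_sub_cancel]
  have hf₁ : f 1 = X 1 := by simp only [f, div_self hL₁, sub_self, zero_smul, add_zero]
  have hfC1 : IsPiecewiseC1 (I.prod 𝓘(ℝ, F)) (sectionCurve F f) 0 1 :=
    contMDiffOn_add_smul_parallel hX hY ((hγ.contDiffOn_arcLength one_pos).mono fun _ _ _ _ h ↦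
      contDiffOn_const.sub (h.1.div_const _))
  have hdist : sasakiEDist cov ⟨γ 0, e₁⟩ ⟨γ 1, X 1⟩
      ≤ pathELength (I.prod 𝓘(ℝ, F)) (sectionCurve F f) 0 1 := by
    rw [← hf₀, ← hf₁]
    exact hfC1.riemannianEDist_le_pathELength one_pos
  refine (pow_le_pow_left' hdist 2).trans ?_
  rw [add_comm]
  have hspeed := sasaki_enorm_mfderiv_add_smul_parallel_sq hmetric hγ hγ₀ hX hY
  rw [pathELength_eq_lintegral_mfderiv_Icc] at hL hγ₀ hspeed
  rw [pathELength_eq_lintegral_mfderiv_Icc, pathELength_eq_lintegral_mfderiv_Icc]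
  refine sq_lintegral_le_of_sq_eq enorm_ne_top hγ₀ hL (ae_restrict_Icc_of_cofinite ?_)
  exact hspeed

end UpperBound

section ChartSegments

open AffineMap (lineMap)

variable {E : Type*} [NormedAddCommGroup E] [NormedSpace ℝ E]
  {H : Type*} [TopologicalSpace H] {J : ModelWithCorners ℝ E H}
  {M : Type*} [TopologicalSpace M] [ChartedSpace H M]
  {p : M} {U : Set E} {u₁ u₂ : E} {s s' t : ℝ}

variable (J) in
/-- The derivative of the inverse of the preferred chart at `p`: the tangent vector at the point
with coordinates `u` as a function of its components. -/
def chartSymmDeriv (p : M) (u : E) : E →L[ℝ] TangentSpace J ((extChartAt J p).symm u) :=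
  mfderiv 𝓘(ℝ, E) J (extChartAt J p).symm u

variable (J) in
/-- The curve, parametrized on `[s, s']`, that is affine in the preferred chart at `p`. -/
def chartSegment (p : M) (u₁ u₂ : E) (s s' t : ℝ) : M :=
  (extChartAt J p).symm (lineMap u₁ u₂ ((t - s) / (s' - s)))

theorem chartSegment_left (p : M) (u₁ u₂ : E) (s s' : ℝ) :
    chartSegment J p u₁ u₂ s s' s = (extChartAt J p).symm u₁ := by
  rw [chartSegment, sub_self, zero_div, AffineMap.lineMap_apply_zero]

theorem chartSegment_right (p : M) (u₁ u₂ : E) (hs : s < s') :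
    chartSegment J p u₁ u₂ s s' s' = (extChartAt J p).symm u₂ := by
  rw [chartSegment, div_self (sub_pos.2 hs).ne', AffineMap.lineMap_apply_one]

theorem lineMap_div_mem (hU : Convex ℝ U) (h₁ : u₁ ∈ U) (h₂ : u₂ ∈ U) (hs : s < s')
    (ht : t ∈ Icc s s') : lineMap u₁ u₂ ((t - s) / (s' - s)) ∈ U :=
  hU.lineMap_mem h₁ h₂ ⟨div_nonneg (sub_nonneg.2 ht.1) (sub_pos.2 hs).le,
    div_le_one_of_le₀ (sub_le_sub_right ht.2 s) (sub_pos.2 hs).le⟩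

theorem contMDiffOn_chartSegment {n : WithTop ℕ∞} [IsManifold J n M] (hU : Convex ℝ U)
    (hUt : U ⊆ (extChartAt J p).target) (h₁ : u₁ ∈ U) (h₂ : u₂ ∈ U) (hs : s < s') :
    ContMDiffOn 𝓘(ℝ, ℝ) J n (chartSegment J p u₁ u₂ s s') (Icc s s') := by
  refine (contMDiffOn_extChartAt_symm p).comp (ContDiffOn.contMDiffOn ?_)
    fun t ht ↦ hUt (lineMap_div_mem hU h₁ h₂ hs ht)
  simp only [AffineMap.lineMap_apply_module]
  fun_prop

variable [J.Boundaryless] [IsManifold J 1 M]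

theorem chartSymmDeriv_injective {u : E} (hu : u ∈ (extChartAt J p).target) :
    Function.Injective (chartSymmDeriv J p u) := by
  have h := isInvertible_mfderivWithin_extChartAt_symm (I := J) hu
  rw [J.range_eq_univ, mfderivWithin_univ] at h
  exact h.injective

theorem mdifferentiableAt_extChartAt_symm {u : E} (hu : u ∈ (extChartAt J p).target) :
    MDifferentiableAt 𝓘(ℝ, E) J (extChartAt J p).symm u :=
  ((contMDiffOn_extChartAt_symm p).contMDiffAt
    ((isOpen_extChartAt_target p).mem_nhds hu)).mdifferentiableAt one_ne_zero

theorem mfderiv_extChartAt_symm_comp {u : ℝ → E} (hu : u t ∈ (extChartAt J p).target)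
    (hd : DifferentiableAt ℝ u t) :
    mfderiv 𝓘(ℝ, ℝ) J (fun s ↦ (extChartAt J p).symm (u s)) t (1 : ℝ)
      = chartSymmDeriv J p (u t) (deriv u t) := by
  have h := mfderiv_comp_apply (I' := 𝓘(ℝ, E)) t (mdifferentiableAt_extChartAt_symm hu)
    hd.mdifferentiableAt (1 : ℝ)
  rwa [mfderiv_eq_fderiv] at h

theorem mfderiv_chartSegment
    (ht : lineMap u₁ u₂ ((t - s) / (s' - s)) ∈ (extChartAt J p).target) :
    mfderiv 𝓘(ℝ, ℝ) J (chartSegment J p u₁ u₂ s s') t (1 : ℝ)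
      = chartSymmDeriv J p (lineMap u₁ u₂ ((t - s) / (s' - s))) ((s' - s)⁻¹ • (u₂ - u₁)) := by
  have hd : HasDerivAt (fun t ↦ lineMap (k := ℝ) u₁ u₂ ((t - s) / (s' - s)))
      ((1 / (s' - s)) • (u₂ - u₁)) t :=
    AffineMap.hasDerivAt_lineMap.scomp t (((hasDerivAt_id t).sub_const s).div_const _)
  rw [one_div] at hd
  exact hd.deriv ▸ mfderiv_extChartAt_symm_comp ht hd.differentiableAt

theorem isRegularOn_chartSegment [IsManifold J ∞ M] (hU : Convex ℝ U)
    (hUt : U ⊆ (extChartAt J p).target) (h₁ : u₁ ∈ U) (h₂ : u₂ ∈ U) (hne : u₁ ≠ u₂)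
    (hs : s < s') : IsRegularOn J (chartSegment J p u₁ u₂ s s') s s' := by
  have hsmooth := contMDiffOn_chartSegment (n := ∞) hU hUt h₁ h₂ hs
  refine ⟨hsmooth, fun t ht hzero ↦ ?_⟩
  have hmem := hUt (lineMap_div_mem hU h₁ h₂ hs ht)
  have hd : MDifferentiableAt 𝓘(ℝ, ℝ) J (chartSegment J p u₁ u₂ s s') t :=
    (mdifferentiableAt_extChartAt_symm hmem).comp t
      (f := fun t ↦ lineMap u₁ u₂ ((t - s) / (s' - s)))
      (DifferentiableAt.mdifferentiableAt (by simp only [AffineMap.lineMap_apply_module]; fun_prop))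
  rw [mfderivWithin_eq_mfderiv (uniqueMDiffWithinAt_iff_uniqueDiffWithinAt.2
    (uniqueDiffOn_Icc hs t ht)) hd] at hzero
  have hvel := chartSymmDeriv_injective hmem
    ((mfderiv_chartSegment hmem).symm.trans (hzero.trans (map_zero _).symm))
  exact smul_ne_zero (inv_pos.2 (sub_pos.2 hs)).ne' (sub_ne_zero.2 hne.symm) hvel

end ChartSegments

section NearlyFlat

open AffineMap (lineMap)
open scoped NNReal

variable {E : Type*} [NormedAddCommGroup E] [NormedSpace ℝ E]
  {H : Type*} [TopologicalSpace H] {J : ModelWithCorners ℝ E H}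
  {M : Type*} [TopologicalSpace M] [ChartedSpace H M]
  [RiemannianBundle (fun x : M ↦ TangentSpace J x)]
  {p : M} {C : ℝ≥0} {U : Set E} {u₁ u₂ : E} {s s' t : ℝ}

variable (J) in
/-- `U` is a convex open set of coordinates in the preferred chart at `p`, containing those of `p`,
on which the metric differs from the constant metric at `p` by a factor of at most `C`. -/
structure IsNearlyFlatOn (p : M) (C : ℝ≥0) (U : Set E) : Prop where
  convex : Convex ℝ U
  isOpen : IsOpen U
  mem : extChartAt J p p ∈ U
  subset_target : U ⊆ (extChartAt J p).target
  enorm_le : ∀ u ∈ U, ∀ w,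
    ‖chartSymmDeriv J p u w‖ₑ ≤ C * ‖chartSymmDeriv J p (extChartAt J p p) w‖ₑ
  enorm_center_le : ∀ u ∈ U, ∀ w,
    ‖chartSymmDeriv J p (extChartAt J p p) w‖ₑ ≤ C * ‖chartSymmDeriv J p u w‖ₑ

theorem IsNearlyFlatOn.eventually_mem (h : IsNearlyFlatOn J p C U) :
    ∀ᶠ x in 𝓝 p, x ∈ (extChartAt J p).source ∧ extChartAt J p x ∈ U :=
  Filter.Eventually.and (extChartAt_source_mem_nhds p)
    ((continuousAt_extChartAt p).eventually_mem (h.isOpen.mem_nhds h.mem))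

theorem enorm_mfderiv_congr {α β : ℝ → M} (h : α =ᶠ[𝓝 t] β) :
    ‖mfderiv 𝓘(ℝ, ℝ) J α t (1 : ℝ)‖ₑ = ‖mfderiv 𝓘(ℝ, ℝ) J β t (1 : ℝ)‖ₑ := by
  have hfiber : ∀ {x y : M}, x = y → ∀ w : E,
      ‖(show TangentSpace J x from w)‖ₑ = ‖(show TangentSpace J y from w)‖ₑ := by
    rintro x _ rfl w
    rfl
  have hderiv := congrArg (fun L : ℝ →L[ℝ] E ↦ L 1) (h.mfderiv_eq (I := 𝓘(ℝ, ℝ)) (I' := J))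
  exact (hfiber h.self_of_nhds _).trans (congrArg (fun w : TangentSpace J (β t) ↦ ‖w‖ₑ) hderiv)

theorem enorm_le_mul_enorm_of_sphere {W W' : Type*} [NormedAddCommGroup W] [NormedSpace ℝ W]
    [NormedAddCommGroup W'] [NormedSpace ℝ W'] {L : E →L[ℝ] W} {L' : E →L[ℝ] W'}
    (h : ∀ w ∈ Metric.sphere (0 : E) 1, ‖L w‖ ≤ C * ‖L' w‖) (w : E) : ‖L w‖ₑ ≤ C * ‖L' w‖ₑ := by
  suffices hw : ‖L w‖ ≤ C * ‖L' w‖ from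
    (ENNReal.coe_le_coe.2 (show ‖L w‖₊ ≤ C * ‖L' w‖₊ from hw)).trans_eq (ENNReal.coe_mul _ _)
  rcases eq_or_ne w 0 with rfl | hw
  · simp
  have hpos : 0 < ‖w‖⁻¹ := inv_pos.2 (norm_pos_iff.2 hw)
  have hunit := h (‖w‖⁻¹ • w) (by simp [norm_smul, hw])
  rw [map_smul, map_smul, norm_smul, norm_smul, mul_left_comm, norm_inv, norm_norm] at hunit
  exact le_of_mul_le_mul_left hunit hpos

variable [J.Boundaryless] [IsManifold J 1 M]

theorem continuousOn_norm_chartSymmDeriv (hN : Continuous fun v : TangentBundle J M ↦ ‖v.2‖)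
    (p : M) : ContinuousOn (fun z : E × E ↦ ‖chartSymmDeriv J p z.1 z.2‖)
      ((extChartAt J p).target ×ˢ univ) := by
  have ho := isOpen_extChartAt_target (I := J) p
  have htangent := (contMDiffOn_extChartAt_symm (I := J) (n := 1)
    p).continuousOn_tangentMapWithin le_rfl ho.uniqueMDiffOn
  have hpair : Continuous (fun z : E × E ↦ (⟨z.1, z.2⟩ : TangentBundle 𝓘(ℝ, E) E)) :=
    (tangentBundleModelSpaceHomeomorph 𝓘(ℝ, E)).symm.continuous
  have hvector : ContinuousOn (fun z : E × E ↦
      (⟨(extChartAt J p).symm z.1, chartSymmDeriv J p z.1 z.2⟩ : TangentBundle J M))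
      ((extChartAt J p).target ×ˢ univ) := by
    refine (htangent.comp hpair.continuousOn fun z hz ↦ hz.1).congr fun z hz ↦ ?_
    simp only [Function.comp, tangentMapWithin]
    rw [mfderivWithin_of_isOpen ho hz.1]
    rfl
  have hnorm := ContinuousOn.comp (hN.continuousOn (s := univ)) hvector fun _ _ ↦ mem_univ _
  exact hnorm

theorem IsNearlyFlatOn.enorm_sub_le_pathELength [FiniteDimensional ℝ E]
    (h : IsNearlyFlatOn J p C U) (hs : s < s') {α : ℝ → M}
    (hα : ContMDiffOn 𝓘(ℝ, ℝ) J 1 α (Icc s s'))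
    (hU : ∀ t ∈ Icc s s', α t ∈ (extChartAt J p).source ∧ extChartAt J p (α t) ∈ U) :
    ‖chartSymmDeriv J p (extChartAt J p p) (extChartAt J p (α s') - extChartAt J p (α s))‖ₑ
      ≤ C * pathELength J α s s' := by
  set L := chartSymmDeriv J p (extChartAt J p p)
  set u : ℝ → E := fun t ↦ extChartAt J p (α t)
  have : FiniteDimensional ℝ (TangentSpace J ((extChartAt J p).symm (extChartAt J p p))) :=
    inferInstanceAs (FiniteDimensional ℝ E)
  have huc : ContinuousOn u (Icc s s') :=
    (continuousOn_extChartAt p).comp hα.continuousOn fun t ht ↦ (hU t ht).1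
  rw [map_sub, pathELength_eq_lintegral_mfderiv_Icc, ← lintegral_const_mul' _ _ ENNReal.coe_ne_top]
  refine enorm_sub_le_lintegral (u := fun t ↦ L (u t)) hs.le
    (L.continuous.comp_continuousOn huc) ?_
  filter_upwards [(IsPiecewiseC1.of_contMDiffOn hα).mdifferentiableAt,
    (finite_singleton s).compl_mem_cofinite, (finite_singleton s').compl_mem_cofinite]
    with t hαt hts hts' ht
  have hmem := hU t ht
  have hnhds : Icc s s' ∈ 𝓝 t :=
    Icc_mem_nhds (lt_of_le_of_ne ht.1 (Ne.symm hts)) (lt_of_le_of_ne ht.2 hts')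
  have hut : DifferentiableAt ℝ u t := ((mdifferentiableAt_extChartAt (I := J)
    (by rw [← extChartAt_source J]; exact hmem.1)).comp t (hαt ht)).differentiableAt
  have hLu : HasDerivAt (fun t ↦ L (u t)) (L (deriv u t)) t :=
    L.hasFDerivAt.comp_hasDerivAt t hut.hasDerivAt
  have hαu : α =ᶠ[𝓝 t] fun s ↦ (extChartAt J p).symm (u s) :=
    Filter.eventually_of_mem hnhds fun x hx ↦ ((extChartAt J p).left_inv (hU x hx).1).symm
  refine ⟨hLu.differentiableAt, ?_⟩
  have hspeed := (enorm_mfderiv_congr hαu).trans (congrArg enorm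
    (mfderiv_extChartAt_symm_comp ((extChartAt J p).map_source hmem.1) hut))
  rw [hLu.deriv]
  exact (h.enorm_center_le _ hmem.2 _).trans_eq (congrArg ((C : ℝ≥0∞) * ·) hspeed.symm)

theorem IsNearlyFlatOn.pathELength_chartSegment_le (h : IsNearlyFlatOn J p C U)
    (h₁ : u₁ ∈ U) (h₂ : u₂ ∈ U) (hs : s < s') :
    pathELength J (chartSegment J p u₁ u₂ s s') s s'
      ≤ C * ‖chartSymmDeriv J p (extChartAt J p p) (u₂ - u₁)‖ₑ := by
  have hs' : 0 < s' - s := sub_pos.2 hs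
  have hspeed : ∀ t ∈ Icc s s', ‖mfderiv 𝓘(ℝ, ℝ) J (chartSegment J p u₁ u₂ s s') t (1 : ℝ)‖ₑ
      ≤ C * ‖chartSymmDeriv J p (extChartAt J p p) (u₂ - u₁)‖ₑ * ‖(s' - s)⁻¹‖ₑ := fun t ht ↦ by
    have hmem := lineMap_div_mem h.convex h₁ h₂ hs ht
    refine (congrArg enorm (mfderiv_chartSegment (h.subset_target hmem))).trans_le ?_
    refine (h.enorm_le _ hmem _).trans_eq ?_
    rw [map_smul, enorm_smul, mul_left_comm, mul_comm]
  rw [pathELength_eq_lintegral_mfderiv_Icc]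
  refine (setLIntegral_mono' measurableSet_Icc hspeed).trans_eq ?_
  rw [setLIntegral_const, Real.volume_Icc, mul_assoc, Real.enorm_of_nonneg (inv_pos.2 hs').le,
    ← ENNReal.ofReal_mul (inv_pos.2 hs').le, inv_mul_cancel₀ hs'.ne', ENNReal.ofReal_one, mul_one]

theorem exists_isNearlyFlatOn [FiniteDimensional ℝ E]
    (hN : Continuous fun v : TangentBundle J M ↦ ‖v.2‖) (p : M) (hC : 1 < C) :
    ∃ U, IsNearlyFlatOn J p C U := by
  set u₀ := extChartAt J p p
  have ho := isOpen_extChartAt_target (I := J) p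
  have hu₀ : u₀ ∈ (extChartAt J p).target := mem_extChartAt_target p
  have hc := continuousOn_norm_chartSymmDeriv hN p
  have hsphere : ∀ᶠ u in 𝓝 u₀, ∀ w ∈ Metric.sphere (0 : E) 1,
      ‖chartSymmDeriv J p u w‖ ≤ C * ‖chartSymmDeriv J p u₀ w‖ ∧
      ‖chartSymmDeriv J p u₀ w‖ ≤ C * ‖chartSymmDeriv J p u w‖ := by
    refine (isCompact_sphere (0 : E) 1).eventually_forall_of_forall_eventually fun w hw ↦ ?_
    have hvar : ContinuousAt (fun z : E × E ↦ ‖chartSymmDeriv J p z.1 z.2‖) (u₀, w) :=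
      hc.continuousAt ((ho.prod isOpen_univ).mem_nhds ⟨hu₀, mem_univ _⟩)
    have hfix : ContinuousAt (fun z : E × E ↦ ‖chartSymmDeriv J p u₀ z.2‖) (u₀, w) :=
      ((chartSymmDeriv J p u₀).continuous.norm.comp continuous_snd).continuousAt
    have hpos : 0 < ‖chartSymmDeriv J p u₀ w‖ := norm_pos_iff.2
      ((map_ne_zero_iff _ (chartSymmDeriv_injective hu₀)).2 (ne_zero_of_mem_unit_sphere ⟨w, hw⟩))
    have hlt : ‖chartSymmDeriv J p u₀ w‖ < C * ‖chartSymmDeriv J p u₀ w‖ :=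
      lt_mul_of_one_lt_left hpos hC
    filter_upwards [hvar.eventually_lt (hfix.const_mul (C : ℝ)) hlt,
      hfix.eventually_lt (hvar.const_mul (C : ℝ)) hlt] with z hz hz'
    exact ⟨hz.le, hz'.le⟩
  obtain ⟨r, hr, hsub⟩ := Metric.mem_nhds_iff.1 (Filter.inter_mem hsphere (ho.mem_nhds hu₀))
  exact ⟨Metric.ball u₀ r, convex_ball _ _, Metric.isOpen_ball, Metric.mem_ball_self hr,
    fun u hu ↦ (hsub hu).2,
    fun u hu ↦ enorm_le_mul_enorm_of_sphere fun w hw ↦ ((hsub hu).1 w hw).1,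
    fun u hu ↦ enorm_le_mul_enorm_of_sphere fun w hw ↦ ((hsub hu).1 w hw).2⟩

end NearlyFlat

section RegularPaths

variable {B : Type*} [NormedAddCommGroup B] [NormedSpace ℝ B]
  {H : Type*} [TopologicalSpace H] {I : ModelWithCorners ℝ B H}
  {N : Type*} [TopologicalSpace N] [ChartedSpace H N] {γ γ' : ℝ → N} {a b : ℝ} {x y z : N}

theorem IsRegularOn.congr (h : IsRegularOn I γ a b) (hγ : ∀ t ∈ Icc a b, γ' t = γ t) :
    IsRegularOn I γ' a b := by
  refine ⟨h.1.congr hγ, fun t ht hzero ↦ h.2 t ht ?_⟩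
  have hderiv := mfderivWithin_congr (I := 𝓘(ℝ, ℝ)) (I' := I) hγ (hγ t ht)
  exact (congrArg (fun L : ℝ →L[ℝ] B ↦ L 1) hderiv).symm.trans hzero

theorem PiecewiseOn.congr_isRegularOn (h : PiecewiseOn (IsRegularOn I γ) a b)
    (hγ : ∀ t ∈ Icc a b, γ' t = γ t) : PiecewiseOn (IsRegularOn I γ') a b :=
  h.mono fun _ _ _ hsub hs ↦ hs.congr fun t ht ↦ hγ t (hsub ht)

variable (I) in
/-- `x` and `y` are the end points of piecewise regular curves parametrized on arbitrary
nondegenerate intervals. -/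
def RegularlyJoined (x y : N) : Prop :=
  ∀ a b : ℝ, a < b → ∃ γ : ℝ → N, γ a = x ∧ γ b = y ∧ PiecewiseOn (IsRegularOn I γ) a b

theorem RegularlyJoined.trans (h : RegularlyJoined I x y) (h' : RegularlyJoined I y z) :
    RegularlyJoined I x z := by
  intro a b hab
  obtain ⟨c, hac, hcb⟩ := exists_between hab
  obtain ⟨γ, rfl, hγc, hγ⟩ := h a c hac
  obtain ⟨γ', hγ'c, rfl, hγ'⟩ := h' c b hcb
  obtain ⟨k, hk, hk'⟩ := exists_glue (hγc.trans hγ'c.symm)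
  exact ⟨k, hk a hac.le, hk' b hcb.le, (hγ.congr_isRegularOn fun t ht ↦ hk t ht.2).trans
    (hγ'.congr_isRegularOn fun t ht ↦ hk' t ht.1)⟩

variable [I.Boundaryless] [IsManifold I ∞ N]

theorem regularlyJoined_of_ne {p : N} {U : Set B} (hU : Convex ℝ U)
    (hUt : U ⊆ (extChartAt I p).target) {u v : B} (hu : u ∈ U) (hv : v ∈ U) (hne : u ≠ v) :
    RegularlyJoined I ((extChartAt I p).symm u) ((extChartAt I p).symm v) :=
  fun a b hab ↦ ⟨chartSegment I p u v a b, chartSegment_left p u v a b,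
    chartSegment_right p u v hab, .of_forall fun _ _ hs hsub ↦
      (isRegularOn_chartSegment hU hUt hu hv hne hab).mono hs hsub⟩

variable [Nontrivial B]

theorem eventually_regularlyJoined (x : N) :
    ∀ᶠ y in 𝓝 x, RegularlyJoined I x y ∧ RegularlyJoined I y x := by
  obtain ⟨r, hr, hball⟩ := Metric.mem_nhds_iff.1 (extChartAt_target_mem_nhds (I := I) x)
  have hx : extChartAt I x x ∈ Metric.ball (extChartAt I x x) r := Metric.mem_ball_self hr
  have hjoin : ∀ u ∈ Metric.ball (extChartAt I x x) r, ∀ v ∈ Metric.ball (extChartAt I x x) r,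
      RegularlyJoined I ((extChartAt I x).symm u) ((extChartAt I x).symm v) := fun u hu v hv ↦ by
    obtain ⟨w, hw, hwuv⟩ := (dense_compl_pair u v).inter_open_nonempty _ Metric.isOpen_ball ⟨_, hu⟩
    rw [mem_compl_iff, mem_insert_iff, mem_singleton_iff, not_or] at hwuv
    exact (regularlyJoined_of_ne (convex_ball _ _) hball hu hw (Ne.symm hwuv.1)).trans
      (regularlyJoined_of_ne (convex_ball _ _) hball hw hv hwuv.2)
  filter_upwards [extChartAt_source_mem_nhds (I := I) x,
    (continuousAt_extChartAt (I := I) x).eventually_mem (Metric.ball_mem_nhds _ hr)] with y hy hyr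
  have hxy := hjoin _ hx _ hyr
  have hyx := hjoin _ hyr _ hx
  rw [extChartAt_to_inv, (extChartAt I x).left_inv hy] at hxy hyx
  exact ⟨hxy, hyx⟩

theorem exists_isPiecewiseRegular [PreconnectedSpace N] (x y : N) :
    ∃ γ : ℝ → N, IsPiecewiseRegular I γ ∧ γ 0 = x ∧ γ 1 = y := by
  have htrans : IsTrans N (RegularlyJoined I) := ⟨fun _ _ _ ↦ RegularlyJoined.trans⟩
  obtain ⟨γ, h₀, h₁, hγ⟩ :=
    PreconnectedSpace.induction₂' _ eventually_regularlyJoined htrans x y 0 1 one_pos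
  exact ⟨γ, isPiecewiseRegular_iff.2 hγ, h₀, h₁⟩

end RegularPaths

section AdmissibleCurves

variable {B : Type*} [NormedAddCommGroup B] [NormedSpace ℝ B]
  {H : Type*} [TopologicalSpace H] {I : ModelWithCorners ℝ B H}
  {N : Type*} [TopologicalSpace N] [ChartedSpace H N]
  {F : Type*} [NormedAddCommGroup F] [NormedSpace ℝ F]
  {V : N → Type*} [TopologicalSpace (TotalSpace F V)]
  [∀ x, TopologicalSpace (V x)] [FiberBundle F V]
  {β β' : ℝ → TotalSpace F V} {a b c : ℝ} {x y z : TotalSpace F V} {L L' : ℝ≥0∞}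

variable (I) in
/-- The curves of the total space used to compute its distance: piecewise `C^1` curves whose
projection to the base is piecewise regular. -/
def IsAdmissibleOn (β : ℝ → TotalSpace F V) (a b : ℝ) : Prop :=
  IsPiecewiseC1 (I.prod 𝓘(ℝ, F)) β a b ∧ PiecewiseOn (IsRegularOn I fun t ↦ (β t).proj) a b

theorem IsAdmissibleOn.congr (h : IsAdmissibleOn I β a b) (hβ : ∀ t ∈ Icc a b, β' t = β t) :
    IsAdmissibleOn I β' a b :=
  ⟨h.1.mono fun _ _ _ hsub hs ↦ hs.congr fun t ht ↦ hβ t (hsub ht),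
    h.2.congr_isRegularOn fun t ht ↦ congrArg TotalSpace.proj (hβ t ht)⟩

theorem proj_extChartAt_symm {p : TotalSpace F V} {u : B × F}
    (hu : u ∈ (extChartAt (I.prod 𝓘(ℝ, F)) p).target) :
    u.1 ∈ (extChartAt I p.proj).target ∧
      ((extChartAt (I.prod 𝓘(ℝ, F)) p).symm u).proj = (extChartAt I p.proj).symm u.1 := by
  rw [FiberBundle.extChartAt_target] at hu
  rw [FiberBundle.extChartAt]
  exact ⟨hu.1.1, Trivialization.proj_symm_apply' _ hu.1.2⟩

variable [RiemannianBundle (fun p : TotalSpace F V ↦ TangentSpace (I.prod 𝓘(ℝ, F)) p)]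

variable (I) in
/-- `x` and `y` are joined by an admissible curve, parametrized on `[a, b]`, of length at most
`L`. -/
def AdmissiblyJoined (x y : TotalSpace F V) (a b : ℝ) (L : ℝ≥0∞) : Prop :=
  ∃ β : ℝ → TotalSpace F V, β a = x ∧ β b = y ∧ IsAdmissibleOn I β a b ∧
    pathELength (I.prod 𝓘(ℝ, F)) β a b ≤ L

theorem AdmissiblyJoined.mono (h : AdmissiblyJoined I x y a b L) (hL : L ≤ L') :
    AdmissiblyJoined I x y a b L' :=
  let ⟨β, h₀, h₁, hβ, hle⟩ := h
  ⟨β, h₀, h₁, hβ, hle.trans hL⟩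

theorem AdmissiblyJoined.trans (hab : a < b) (hbc : b < c) (h : AdmissiblyJoined I x y a b L)
    (h' : AdmissiblyJoined I y z b c L') : AdmissiblyJoined I x z a c (L + L') := by
  obtain ⟨β, rfl, hβb, hβ, hL⟩ := h
  obtain ⟨β', hβ'b, rfl, hβ', hL'⟩ := h'
  obtain ⟨k, hk, hk'⟩ := exists_glue (hβb.trans hβ'b.symm)
  have hkβ := hβ.congr fun t ht ↦ hk t ht.2
  have hkβ' := hβ'.congr fun t ht ↦ hk' t ht.1
  refine ⟨k, hk a hab.le, hk' c hbc.le, ⟨hkβ.1.trans hkβ'.1, hkβ.2.trans hkβ'.2⟩, ?_⟩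
  rw [← pathELength_add hab.le hbc.le, pathELength_congr fun t ht ↦ hk t ht.2,
    pathELength_congr fun t ht ↦ hk' t ht.1]
  exact add_le_add hL hL'

end AdmissibleCurves

section AdmissibleApproximation

open scoped NNReal

variable {B : Type*} [NormedAddCommGroup B] [NormedSpace ℝ B]
  {H : Type*} [TopologicalSpace H] {I : ModelWithCorners ℝ B H}
  {N : Type*} [TopologicalSpace N] [ChartedSpace H N]
  {F : Type*} [NormedAddCommGroup F] [NormedSpace ℝ F]

theorem exists_mem_fst_ne_enorm_lt [Nontrivial B] {W : Type*} [NormedAddCommGroup W]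
    [NormedSpace ℝ W] (A : B × F →L[ℝ] W) {u : B × F} {U : Set (B × F)} (hU : U ∈ 𝓝 u)
    (v : B × F) {η : ℝ≥0∞} (hη : 0 < η) :
    ∃ w ∈ U, u.1 ≠ w.1 ∧ w.1 ≠ v.1 ∧ ‖A (w - u)‖ₑ + ‖A (v - w)‖ₑ < ‖A (v - u)‖ₑ + η := by
  have hc : Continuous fun w ↦ ‖A (w - u)‖ₑ + ‖A (v - w)‖ₑ := by fun_prop
  have hlt : ∀ᶠ w in 𝓝 u, ‖A (w - u)‖ₑ + ‖A (v - w)‖ₑ < ‖A (v - u)‖ₑ + η :=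
    hc.continuousAt.eventually_lt_const (by
      simpa only [sub_self, map_zero, enorm_zero, zero_add]
        using ENNReal.lt_add_right enorm_ne_top hη.ne')
  obtain ⟨w, hwuv, hwU, hw⟩ := ((dense_compl_pair u.1 v.1).preimage
    isOpenMap_fst).inter_nhds_nonempty (Filter.inter_mem hU hlt)
  rw [mem_preimage, mem_compl_iff, mem_insert_iff, mem_singleton_iff, not_or] at hwuv
  exact ⟨w, hwU, Ne.symm hwuv.1, hwuv.2, hw⟩

variable [I.Boundaryless] [IsManifold I ∞ N]
  {V : N → Type*} [TopologicalSpace (TotalSpace F V)]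
  [∀ x, AddCommGroup (V x)] [∀ x, Module ℝ (V x)] [∀ x, TopologicalSpace (V x)]
  [FiberBundle F V] [VectorBundle ℝ F V] [ContMDiffVectorBundle 1 F V I]
  {a b : ℝ} {x y : TotalSpace F V} {L : ℝ≥0∞}

theorem isAdmissibleOn_chartSegment {p : TotalSpace F V} {U : Set (B × F)} (hU : Convex ℝ U)
    (hUt : U ⊆ (extChartAt (I.prod 𝓘(ℝ, F)) p).target) {u v : B × F} (hu : u ∈ U) (hv : v ∈ U)
    (hne : u.1 ≠ v.1) (hab : a < b) :
    IsAdmissibleOn I (chartSegment (I.prod 𝓘(ℝ, F)) p u v a b) a b := by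
  refine ⟨.of_contMDiffOn (contMDiffOn_chartSegment hU hUt hu hv hab), ?_⟩
  have hreg : IsRegularOn I (chartSegment I p.proj u.1 v.1 a b) a b :=
    isRegularOn_chartSegment (hU.linear_image (LinearMap.fst ℝ B F))
      (image_subset_iff.2 fun w hw ↦ (proj_extChartAt_symm (hUt hw)).1)
      (mem_image_of_mem _ hu) (mem_image_of_mem _ hv) hne hab
  refine PiecewiseOn.congr_isRegularOn (.of_forall fun _ _ hs hsub ↦ hreg.mono hs hsub)
    fun t ht ↦ ((proj_extChartAt_symm (hUt (lineMap_div_mem hU hu hv hab ht))).2).trans ?_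
  rw [chartSegment, AffineMap.fst_lineMap]

variable [RiemannianBundle (fun p : TotalSpace F V ↦ TangentSpace (I.prod 𝓘(ℝ, F)) p)]
  [Nontrivial B]
  {C : ℝ≥0} {η : ℝ≥0∞}

-- A chart segment may be vertical, so the curve takes a small detour.
theorem IsNearlyFlatOn.admissiblyJoined {p : TotalSpace F V} {U : Set (B × F)}
    (h : IsNearlyFlatOn (I.prod 𝓘(ℝ, F)) p C U) {u v : B × F} (hu : u ∈ U) (hv : v ∈ U)
    (hab : a < b) (hη : 0 < η) :
    AdmissiblyJoined I ((extChartAt (I.prod 𝓘(ℝ, F)) p).symm u)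
      ((extChartAt (I.prod 𝓘(ℝ, F)) p).symm v) a b
      (C * (‖chartSymmDeriv (I.prod 𝓘(ℝ, F)) p (extChartAt (I.prod 𝓘(ℝ, F)) p p) (v - u)‖ₑ
        + η)) := by
  obtain ⟨c, hac, hcb⟩ := exists_between hab
  obtain ⟨w, hw, huw, hwv, hlt⟩ := exists_mem_fst_ne_enorm_lt
    (chartSymmDeriv (I.prod 𝓘(ℝ, F)) p (extChartAt (I.prod 𝓘(ℝ, F)) p p))
    (h.isOpen.mem_nhds hu) v hη
  have hjoin : ∀ {u v : B × F} {a b : ℝ}, u ∈ U → v ∈ U → u.1 ≠ v.1 → a < b →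
      AdmissiblyJoined I ((extChartAt (I.prod 𝓘(ℝ, F)) p).symm u)
        ((extChartAt (I.prod 𝓘(ℝ, F)) p).symm v) a b _ := fun hu hv hne hab ↦
    ⟨_, chartSegment_left p _ _ _ _, chartSegment_right p _ _ hab,
      isAdmissibleOn_chartSegment h.convex h.subset_target hu hv hne hab,
      h.pathELength_chartSegment_le hu hv hab⟩
  refine (AdmissiblyJoined.trans hac hcb (hjoin hu hw huw hac) (hjoin hw hv hwv hcb)).mono ?_
  rw [← mul_add]
  gcongr

variable [FiniteDimensional ℝ B] [FiniteDimensional ℝ F]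

theorem admissiblyJoined_of_contMDiffOn
    (hN : Continuous fun v : TangentBundle (I.prod 𝓘(ℝ, F)) (TotalSpace F V) ↦ ‖v.2‖)
    {α : ℝ → TotalSpace F V} (hab : a < b)
    (hα : ContMDiffOn 𝓘(ℝ, ℝ) (I.prod 𝓘(ℝ, F)) 1 α (Icc a b)) (hC : 1 < C) (hη : 0 < η) :
    AdmissiblyJoined I (α a) (α b) a b (C * (C * pathELength (I.prod 𝓘(ℝ, F)) α a b + η)) := by
  suffices h : ∀ η > 0, AdmissiblyJoined I (α a) (α b) a b
    (C * (C * pathELength (I.prod 𝓘(ℝ, F)) α a b + η)) from h η hη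
  refine rel_of_forall_nhdsWithin (R := fun s s' ↦ ∀ η > 0, AdmissiblyJoined I (α s) (α s') s s'
    (C * (C * pathELength (I.prod 𝓘(ℝ, F)) α s s' + η))) hab
    (fun s t u hst htu h h' η hη ↦ ?_) fun t ht ↦ ?_
  · have hη' := ENNReal.half_pos hη.ne'
    refine (AdmissiblyJoined.trans hst htu (h _ hη') (h' _ hη')).mono (le_of_eq ?_)
    rw [← mul_add, add_add_add_comm, ENNReal.add_halves, ← mul_add,
      pathELength_add hst.le htu.le]
  · obtain ⟨U, hU⟩ := exists_isNearlyFlatOn hN (α t) hC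
    refine ⟨_, (hα.continuousOn t ht).eventually hU.eventually_mem,
      fun s s' hs hsub hsU η hη ↦ ?_⟩
    have hjoin := hU.admissiblyJoined (hsU (left_mem_Icc.2 hs.le)).2
      (hsU (right_mem_Icc.2 hs.le)).2 hs hη
    rw [(extChartAt _ _).left_inv (hsU (left_mem_Icc.2 hs.le)).1,
      (extChartAt _ _).left_inv (hsU (right_mem_Icc.2 hs.le)).1] at hjoin
    refine hjoin.mono ?_
    gcongr
    exact hU.enorm_sub_le_pathELength hs (hα.mono hsub) hsU

theorem admissiblyJoined_of_riemannianEDist_lt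
    (hN : Continuous fun v : TangentBundle (I.prod 𝓘(ℝ, F)) (TotalSpace F V) ↦ ‖v.2‖)
    (h : riemannianEDist (I.prod 𝓘(ℝ, F)) x y < L) : AdmissiblyJoined I x y 0 1 L := by
  obtain ⟨α, rfl, rfl, hα, hlt⟩ := exists_lt_of_riemannianEDist_lt h
  obtain ⟨r, hlr, hrL⟩ := ENNReal.lt_iff_exists_nnreal_btwn.1 hlt
  obtain ⟨l, hl⟩ : ∃ l : ℝ≥0, (l : ℝ≥0∞) = pathELength (I.prod 𝓘(ℝ, F)) α 0 1 :=
    ⟨_, ENNReal.coe_toNNReal hlr.ne_top⟩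
  rw [← hl, ENNReal.coe_lt_coe] at hlr
  have hc : Continuous fun ε : ℝ≥0 ↦ (1 + ε) * ((1 + ε) * l + ε) := by fun_prop
  have hev : ∀ᶠ ε : ℝ≥0 in 𝓝[>] 0, (1 + ε) * ((1 + ε) * l + ε) < r :=
    nhdsWithin_le_nhds (hc.continuousAt.eventually_lt_const (by simpa using hlr))
  obtain ⟨ε, hε, hpos⟩ := (hev.and self_mem_nhdsWithin).exists
  refine (admissiblyJoined_of_contMDiffOn hN one_pos hα (lt_add_of_pos_right 1 hpos)
    (ENNReal.coe_pos.2 hpos)).mono (le_trans ?_ hrL.le)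
  rw [← hl]
  exact_mod_cast hε.le

end AdmissibleApproximation

section Formula

variable {B : Type*} [NormedAddCommGroup B] [NormedSpace ℝ B] [FiniteDimensional ℝ B]
  {H : Type*} [TopologicalSpace H] {I : ModelWithCorners ℝ B H}
  {N : Type*} [TopologicalSpace N] [ChartedSpace H N]
  [RiemannianBundle (fun x : N ↦ TangentSpace I x)]
  {F : Type*} [NormedAddCommGroup F] [NormedSpace ℝ F] [FiniteDimensional ℝ F]
  {V : N → Type*} [TopologicalSpace (TotalSpace F V)]
  [∀ x, NormedAddCommGroup (V x)] [∀ x, InnerProductSpace ℝ (V x)]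
  [FiberBundle F V] [VectorBundle ℝ F V] [ContMDiffVectorBundle 1 F V I]
  [IsContMDiffRiemannianBundle I 1 F V] {cov : CovariantDerivative I F V}

theorem IsAdmissibleOn.sq_add_sq_le_pathELength_sq [IsManifold I 1 N]
    (hcov : IsContinuousConnection cov) (hmetric : cov.IsMetricCompatible)
    {β : ℝ → TotalSpace F V} (hβ : IsAdmissibleOn I β 0 1) :
    letI := sasakiBundle cov
    ‖(β 0).2 - parallelTransport cov (fun t ↦ (β t).proj) (β 1).2‖ₑ ^ 2
        + pathELength I (fun t ↦ (β t).proj) 0 1 ^ 2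
      ≤ pathELength (I.prod 𝓘(ℝ, F)) β 0 1 ^ 2 := by
  let _ := sasakiBundle cov
  set γ : ℝ → N := fun t ↦ (β t).proj
  let f : ∀ t, V (γ t) := fun t ↦ (β t).2
  obtain ⟨X, hX₁, hX⟩ := (exists_isParallelSection hcov one_pos
    (isPiecewiseC1_of_isRegularOn hβ.2)).2 (f 1)
  have htransport : ‖(β 0).2 - parallelTransport cov γ (β 1).2‖ₑ = ‖f 0 - X 0‖ₑ := by
    have hP := parallelTransport_eq hmetric hX
    rw [hX₁] at hP
    exact congrArg (fun w : V (γ 0) ↦ ‖f 0 - w‖ₑ) hP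
  have hfibre : ‖f 0 - X 0‖ₑ ≤ ∫⁻ t in Icc (0 : ℝ) 1, ‖covDerivAlong cov β t‖ₑ :=
    enorm_sub_le_lintegral_covDerivAlong (f := f) hmetric zero_le_one (hβ.1.continuousOn one_pos)
      (hX.isPiecewiseC1.continuousOn one_pos) hβ.1.mdifferentiableAt
      (by filter_upwards [hX.isPiecewiseC1.mdifferentiableAt, hX.covDerivAlong_eq_zero]
            with t hd hz ht using ⟨hd ht, hz ht⟩) hX₁.symm
  rw [htransport, pathELength_eq_lintegral_mfderiv_Icc, pathELength_eq_lintegral_mfderiv_Icc]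
  refine (add_le_add_left (pow_le_pow_left' hfibre 2) _).trans
    (sq_lintegral_add_sq_lintegral_le ?_)
  filter_upwards [ae_restrict_Icc_of_cofinite hβ.1.mdifferentiableAt] with t ht
  exact ((add_comm _ _).trans (sasaki_enorm_mfderiv_sq ht).symm).le

theorem exists_isPiecewiseRegular_of_sasakiEDist_lt [Nontrivial B] [I.Boundaryless]
    [IsManifold I ∞ N] [IsContinuousRiemannianBundle B (fun x : N ↦ TangentSpace I x)]
    (hcov : IsContinuousConnection cov) (hmetric : cov.IsMetricCompatible)
    {x y : TotalSpace F V} {r : ℝ≥0∞} (h : sasakiEDist cov x y < r) :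
    ∃ γ : ℝ → N, IsPiecewiseRegular I γ ∧ γ 0 = x.proj ∧ γ 1 = y.proj ∧
      ‖x.2 - parallelTransport cov γ y.2‖ₑ ^ 2 + pathELength I γ 0 1 ^ 2 ≤ r ^ 2 := by
  let _ := sasakiBundle cov
  have := isContinuousRiemannianBundle_of_contMDiff I 1 (F := F) (V := V)
  obtain ⟨β, rfl, rfl, hβ, hlen⟩ :=
    admissiblyJoined_of_riemannianEDist_lt (continuous_sasaki_norm hcov) h
  exact ⟨_, isPiecewiseRegular_iff.2 hβ.2, rfl, rfl,
    (hβ.sq_add_sq_le_pathELength_sq hcov hmetric).trans (pow_le_pow_left' hlen 2)⟩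

theorem IsPiecewiseRegular.sasakiEDist_sq_le [IsManifold I 1 N]
    [IsContinuousRiemannianBundle B (fun x : N ↦ TangentSpace I x)]
    (hcov : IsContinuousConnection cov) (hmetric : cov.IsMetricCompatible) {γ : ℝ → N}
    (hγ : IsPiecewiseRegular I γ) (e₁ : V (γ 0)) (e₂ : V (γ 1)) :
    sasakiEDist cov ⟨γ 0, e₁⟩ ⟨γ 1, e₂⟩ ^ 2 ≤
      ‖e₁ - parallelTransport cov γ e₂‖ₑ ^ 2 + pathELength I γ 0 1 ^ 2 :=
  Sasaki.sasakiEDist_sq_le hcov hmetric (isPiecewiseC1_of_isRegularOn (isPiecewiseRegular_iff.1 hγ))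
    (pathELength_pos (isPiecewiseRegular_iff.1 hγ) one_pos).ne' e₁ e₂

theorem sasakiEDist_ne_top [Nontrivial B] [I.Boundaryless] [IsManifold I ∞ N]
    [PreconnectedSpace N] [IsContinuousRiemannianBundle B (fun x : N ↦ TangentSpace I x)]
    (hcov : IsContinuousConnection cov) (hmetric : cov.IsMetricCompatible)
    (x y : TotalSpace F V) : sasakiEDist cov x y ≠ ⊤ := by
  obtain ⟨q₁, e₁⟩ := x
  obtain ⟨q₂, e₂⟩ := y
  obtain ⟨γ, hγ, rfl, rfl⟩ := exists_isPiecewiseRegular (I := I) q₁ q₂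
  have hlength := (isPiecewiseC1_of_isRegularOn
    (isPiecewiseRegular_iff.1 hγ)).pathELength_ne_top one_pos
  have hsq := ne_top_of_le_ne_top (by finiteness) (hγ.sasakiEDist_sq_le hcov hmetric e₁ e₂)
  exact fun h ↦ hsq (by rw [h, ENNReal.top_pow two_ne_zero])

end Formula

end Sasaki

end

theorem proposition2p1_general
    {B : Type*} [NormedAddCommGroup B] [NormedSpace ℝ B] [FiniteDimensional ℝ B] [Nontrivial B]
    {H : Type*} [TopologicalSpace H] {I : ModelWithCorners ℝ B H} [I.Boundaryless]
    {N : Type*} [TopologicalSpace N] [ChartedSpace H N] [IsManifold I ∞ N] [PreconnectedSpace N]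
    [RiemannianBundle (fun x : N ↦ TangentSpace I x)]
    [IsContinuousRiemannianBundle B (fun x : N ↦ TangentSpace I x)]
    {F : Type*} [NormedAddCommGroup F] [NormedSpace ℝ F] [FiniteDimensional ℝ F]
    {V : N → Type*} [TopologicalSpace (TotalSpace F V)]
    [∀ x, NormedAddCommGroup (V x)] [∀ x, InnerProductSpace ℝ (V x)]
    [FiberBundle F V] [VectorBundle ℝ F V] [ContMDiffVectorBundle 1 F V I]
    [IsContMDiffRiemannianBundle I 1 F V]
    (cov : CovariantDerivative I F V) (hcov : Sasaki.IsContinuousConnection cov)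
    (hmetric : cov.IsMetricCompatible) (q₁ q₂ : N) (e₁ : V q₁) (e₂ : V q₂) :
    Sasaki.sasakiEDist cov ⟨q₁, e₁⟩ ⟨q₂, e₂⟩ ≠ ⊤ ∧
    Sasaki.sasakiEDist cov ⟨q₁, e₁⟩ ⟨q₂, e₂⟩ ^ 2 =
      ⨅ (γ : ℝ → N) (_ : Sasaki.IsPiecewiseRegular I γ ∧ γ 0 = q₁ ∧ γ 1 = q₂),
        (‖e₁ - Sasaki.parallelTransport cov γ e₂‖ₑ ^ 2 + pathELength I γ 0 1 ^ 2) := by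
  refine ⟨Sasaki.sasakiEDist_ne_top hcov hmetric _ _, le_antisymm (le_iInf₂ ?_) ?_⟩
  · rintro γ ⟨hγ, rfl, rfl⟩
    exact hγ.sasakiEDist_sq_le hcov hmetric e₁ e₂
  · refine Sasaki.le_sq_of_forall_gt fun r hr ↦ ?_
    obtain ⟨γ, hγ, h₀, h₁, hle⟩ :=
      Sasaki.exists_isPiecewiseRegular_of_sasakiEDist_lt hcov hmetric hr
    exact (iInf₂_le γ ⟨hγ, h₀, h₁⟩).trans hle

theorem proposition2p1
    -- `N` is a connected smooth manifold of positive finite dimension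
    {B : Type*} [NormedAddCommGroup B] [NormedSpace ℝ B] [FiniteDimensional ℝ B] [Nontrivial B]
    {N : Type*} [TopologicalSpace N] [T2Space N] [SecondCountableTopology N]
    [ChartedSpace B N] [IsManifold 𝓘(ℝ, B) ∞ N] [ConnectedSpace N]
    -- with a smooth Riemannian metric `h`
    [RiemannianBundle (fun x : N ↦ TangentSpace 𝓘(ℝ, B) x)]
    [IsContMDiffRiemannianBundle 𝓘(ℝ, B) ∞ B (fun x : N ↦ TangentSpace 𝓘(ℝ, B) x)]
    -- `V` is a smooth real vector bundle of finite rank over `N` with a smooth bundle metric `κ`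
    {F : Type*} [NormedAddCommGroup F] [NormedSpace ℝ F] [FiniteDimensional ℝ F]
    {V : N → Type*} [TopologicalSpace (TotalSpace F V)]
    [∀ x, NormedAddCommGroup (V x)] [∀ x, InnerProductSpace ℝ (V x)]
    [FiberBundle F V] [VectorBundle ℝ F V] [ContMDiffVectorBundle ∞ F V 𝓘(ℝ, B)]
    [IsContMDiffRiemannianBundle 𝓘(ℝ, B) ∞ F V]
    -- `cov` is a smooth metric connection on `V`
    (cov : CovariantDerivative 𝓘(ℝ, B) F V) (hcov : cov.ContMDiffCovariantDerivative ∞)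
    (hmetric : cov.IsMetricCompatible)
    (q₁ q₂ : N) (e₁ : V q₁) (e₂ : V q₂) :
    Sasaki.sasakiEDist cov ⟨q₁, e₁⟩ ⟨q₂, e₂⟩ ≠ ⊤ ∧
    Sasaki.sasakiEDist cov ⟨q₁, e₁⟩ ⟨q₂, e₂⟩ ^ 2 =
      ⨅ (γ : ℝ → N) (_ : Sasaki.IsPiecewiseRegular 𝓘(ℝ, B) γ ∧ γ 0 = q₁ ∧ γ 1 = q₂),
        (‖e₁ - Sasaki.parallelTransport cov γ e₂‖ₑ ^ 2 + pathELength 𝓘(ℝ, B) γ 0 1 ^ 2) := by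
  have := Sasaki.isContinuousRiemannianBundle_of_contMDiff 𝓘(ℝ, B) ∞ (F := B)
    (V := fun x : N ↦ TangentSpace 𝓘(ℝ, B) x)
  exact proposition2p1_general cov (Sasaki.isContinuousConnection_of_contMDiff hcov) hmetric
    q₁ q₂ e₁ e₂
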